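/- Let $E$ be a finite-dimensional Euclidean vector space and $\mathcal L$ a finite collection of linear subspaces of $E$ (the collision subspaces), and put $C=\bigcup_{L\in\mathcal L}L$. Write $\pi_L$ for the orthogonal projection to $L$. A *point billiard trajectory* is a polygonal curve $q:\mathbb R\to E$ of unit speed whose collision times, i.e. the times $t$ with $q(t)\in C$, are discrete (so no edge lies in any $L\in\mathcal L$), whose velocity changes only at collision times, and such that at each collision the velocities $v_-,v_+$ immediately before and after it satisfy $\|v_-\|=\|v_+\|$ and $\pi_L(v_-)=\pi_L(v_+)$ for some $L\in\mathcal L$ containing the collision point. The vertices of $q$ are its collisions. A vertex is *internal* if the two edges incident to it form a line segment with the vertex in its interior, i.e. if $v_-=v_+$ there. The trajectory is *transverse* if it has no internal vertices. It is *without multiple collisions* if each of its collision points lies in exactly one $L\in\mathcal L$. Fix scale factors $\sigma_L>0$, $L\in\mathcal L$. For $r>0$ let $L^{(r)}=\{x\in E: d(x,L)\le\sigma_L r\}$, $Z_L^{(r)}=\{x\in E: d(x,L)=\sigma_L r\}$ and $\mathcal M^{(r)}=\mathrm{cl}\big(E\setminus\bigcup_{L\in\mathcal L}L^{(r)}\big)$.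 An *$r$-thickened billiard trajectory* is a unit-speed polygonal curve $\mathbb R\to\mathcal M^{(r)}$ that moves in a straight line as long as it touches no $L^{(r)}$, and which touches an $L^{(r)}$ only at points of $Z_L^{(r)}$ that lie in no other $L'^{(r)}$, $L'\in\mathcal L$; at such a point it hits the wall $Z_L^{(r)}$ at a nonzero angle and its velocity is reflected in the tangent hyperplane of the wall (the angle of reflection equals the angle of incidence). **Proposition.** Every transverse point billiard trajectory $q$ without multiple collisions admits an $r$-family: there are $r_0>0$ and $r$-thickened billiard trajectories $q^{(r)}:\mathbb R\to\mathcal M^{(r)}$, $0<r\le r_0$, such that $q^{(r)}\to q$ in the compact-open topology as $r\to0$. -/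

import Mathlib

open Filter Topology

namespace PointBilliards

variable {E : Type*} [NormedAddCommGroup E] [InnerProductSpace ℝ E]

/-- Immediately before time `t` the curve `q` is straight, with constant velocity `v`. -/
def HasVelocityBefore (q : ℝ → E) (t : ℝ) (v : E) : Prop :=
  ∀ᶠ s in 𝓝[≤] t, q s = q t + (s - t) • v

/-- Immediately after time `t` the curve `q` is straight, with constant velocity `v`. -/
def HasVelocityAfter (q : ℝ → E) (t : ℝ) (v : E) : Prop :=
  ∀ᶠ s in 𝓝[≥] t, q s = q t + (s - t) • v

/-- The collision locus `C`, the union of the collision subspaces. -/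
def collisionLocus (𝓛 : Finset (Submodule ℝ E)) : Set E :=
  ⋃ L ∈ 𝓛, (L : Set E)

/-- A point billiard trajectory: a polygonal curve of speed `1`, defined for all time, whose
collision times are discrete (so that no edge lies within a collision subspace), whose velocity
can only change at collisions, and such that at each collision the velocity keeps its norm
(both velocities are unit vectors) and its orthogonal projection to one of the collision
subspaces through the collision point. -/
structure IsPointBilliardTrajectory [FiniteDimensional ℝ E] (𝓛 : Finset (Submodule ℝ E))
    (q : C(ℝ, E)) : Prop where
  discrete_collisions : ∀ t : ℝ, ∀ᶠ s in 𝓝[≠] t, q s ∉ collisionLocus 𝓛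
  velocity : ∀ t : ℝ, ∃ v₁ v₂ : E,
    HasVelocityBefore q t v₁ ∧ HasVelocityAfter q t v₂ ∧ ‖v₁‖ = 1 ∧ ‖v₂‖ = 1 ∧
    (q t ∉ collisionLocus 𝓛 → v₂ = v₁) ∧
    (q t ∈ collisionLocus 𝓛 →
      ∃ L ∈ 𝓛, q t ∈ L ∧ L.starProjection v₂ = L.starProjection v₁)

/-- The vertices of a point billiard trajectory are its collisions. A vertex is internal if the
two edges incident to it form one straight segment with the vertex in its interior; at unit
speed this says that the velocities before and after the collision agree. -/
def IsInternalVertex (𝓛 : Finset (Submodule ℝ E)) (q : C(ℝ, E)) (t : ℝ) : Prop :=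
  q t ∈ collisionLocus 𝓛 ∧ ∃ v : E, HasVelocityBefore q t v ∧ HasVelocityAfter q t v

/-- A trajectory is transverse if it has no internal vertex. -/
def IsTransverse (𝓛 : Finset (Submodule ℝ E)) (q : C(ℝ, E)) : Prop :=
  ∀ t : ℝ, ¬ IsInternalVertex 𝓛 q t

/-- No collision point lies on two distinct collision subspaces. -/
def HasNoMultipleCollisions (𝓛 : Finset (Submodule ℝ E)) (q : C(ℝ, E)) : Prop :=
  ∀ t : ℝ, ∀ L ∈ 𝓛, ∀ L' ∈ 𝓛, q t ∈ L → q t ∈ L' → L = L'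

/-- The tube `L^(r)`: the points at distance at most `σ_L r` from `L`. -/
def tube (σ : Submodule ℝ E → ℝ) (r : ℝ) (L : Submodule ℝ E) : Set E :=
  {x | Metric.infDist x (L : Set E) ≤ σ L * r}

/-- The cylindrical wall `Z^(r)` of `L`: the points at distance exactly `σ_L r` from `L`. -/
def tubeWall (σ : Submodule ℝ E → ℝ) (r : ℝ) (L : Submodule ℝ E) : Set E :=
  {x | Metric.infDist x (L : Set E) = σ L * r}

/-- The thickened table `M^(r)`: the closure of the complement of the union of the tubes. -/
def table (𝓛 : Finset (Submodule ℝ E)) (σ : Submodule ℝ E → ℝ) (r : ℝ) : Set E :=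
  closure (⋃ L ∈ 𝓛, tube σ r L)ᶜ

/-- The unit normal at a point `x ∉ L` to the cylinder around `L` through `x`,
pointing away from `L`. -/
noncomputable def unitNormal [FiniteDimensional ℝ E] (L : Submodule ℝ E) (x : E) : E :=
  ‖x - L.starProjection x‖⁻¹ • (x - L.starProjection x)

/-- A deterministic billiard trajectory on the thickened table: a polygonal curve of speed `1`
in the table, defined for all time, moving freely as long as it touches no tube. Whenever it
touches a tube, the point is a smooth point of the wall of the table (it lies on the wall of this
tube and on no other tube), the curve hits the wall at a nonzero angle, and its velocity is
reflected in the tangent hyperplane of the wall (equal angles of incidence and reflection). -/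
structure IsThickenedTrajectory [FiniteDimensional ℝ E] (𝓛 : Finset (Submodule ℝ E))
    (σ : Submodule ℝ E → ℝ) (r : ℝ) (q : C(ℝ, E)) : Prop where
  mem_table : ∀ t : ℝ, q t ∈ table 𝓛 σ r
  velocity : ∀ t : ℝ, ∃ v₁ v₂ : E,
    HasVelocityBefore q t v₁ ∧ HasVelocityAfter q t v₂ ∧ ‖v₁‖ = 1 ∧ ‖v₂‖ = 1 ∧
    ((∀ L ∈ 𝓛, q t ∉ tube σ r L) → v₂ = v₁) ∧
    (∀ L ∈ 𝓛, q t ∈ tube σ r L →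
      q t ∈ tubeWall σ r L ∧ (∀ L' ∈ 𝓛, L' ≠ L → q t ∉ tube σ r L') ∧
      inner ℝ v₁ (unitNormal L (q t)) < 0 ∧
      v₂ = v₁ - (2 * inner ℝ v₁ (unitNormal L (q t))) • unitNormal L (q t))

/-- An `r`-family for `q`: thickened trajectories `Q r` for `0 < r ≤ r₀` (the other values of `Q`
play no role) that converge to `q` as `r → 0`. The topology of `C(ℝ, E)` is the compact-open
topology. -/
def IsRFamily [FiniteDimensional ℝ E] (𝓛 : Finset (Submodule ℝ E)) (σ : Submodule ℝ E → ℝ)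
    (q : C(ℝ, E)) (r₀ : ℝ) (Q : ℝ → C(ℝ, E)) : Prop :=
  (∀ r : ℝ, 0 < r → r ≤ r₀ → IsThickenedTrajectory 𝓛 σ r (Q r)) ∧
    Tendsto Q (𝓝[>] 0) (𝓝 q)

end PointBilliards

/-!
A transverse point billiard trajectory without multiple collisions is approximated, on longer and
longer time intervals, by trajectories on the thickened table.

*On a bounded interval* `[a, b]` the trajectory is a polygon with end points `q a`, `q b` and
finitely many vertices `x i` on collision subspaces `L i`. For small `r` a shortest polygon with the
same end points and with its `i`-th vertex on the solid tube around `L i` is considered. The tubes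
are convex, so the first order condition at a vertex says that either the polygon is straight there,
or the vertex lies on the wall and the polygon is reflected (`reflection_of_minimal`). The
velocities of `q` form a calibration: they bound the length from below up to `O(r)`
(`IsItinerary.sum_norm_sub_inner_le`). Together with the transversality of the edges to the next
collision subspace this forces the shortest polygons to converge to `q`
(`IsItinerary.tendsto_vertex`). As `q` has no internal vertices, the shortest polygons are indeed
reflected at each vertex for small `r`.

*Outside of the bounded interval* the billiard motion on the thickened table is followed. It may run
into further tubes, even if `q` has no further collisions, because the asymptotic directions of `q`
may lie in collision subspaces. The continuation fails only at a tangency with a tube or at a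
simultaneous contact with two tubes. Lines are described by pairs in `E × E`; reflection in a tube
is an open map on the set of lines meeting the interior of the tube transversally
(`reflectLine_rev_reflectLine`), and the lines with a tangency or a double contact lie in the zero
sets of polynomials which do not vanish identically. So by Baire's theorem the lines for which no
sequence of reflections leads to a bad line, in the future or in the past, are dense
(`dense_isGeneric`). Collisions do not accumulate (`tendsto_atTop_of_isStep`): a limit point `x` of
collisions belongs to all convex tubes that are met infinitely often, so that `⟪q - x, v⟫ - t` is
eventually monotone along the motion, which is possible only if the motion is straight. Hence the
shortest polygons can be perturbed to motions which exist for all times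
(`IsItinerary.exists_isThickenedTrajectory`).

A diagonal argument (`exists_family_tendsto`) combines the approximations on bounded intervals.
-/

open Filter Topology
open scoped InnerProductSpace ContDiff

set_option linter.unusedSectionVars false

namespace PointBilliards

variable {E : Type*} [NormedAddCommGroup E] [InnerProductSpace ℝ E] [FiniteDimensional ℝ E]

/-! ### The component orthogonal to a subspace, and tubes -/

/-- The component of a vector orthogonal to `L`. -/
noncomputable def perp (L : Submodule ℝ E) : E →L[ℝ] E := Lᗮ.starProjection

lemma perp_apply (L : Submodule ℝ E) (x : E) : perp L x = x - L.starProjection x :=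
  Submodule.starProjection_orthogonal_val x

lemma perp_eq_zero_iff {L : Submodule ℝ E} {x : E} : perp L x = 0 ↔ x ∈ L := by
  rw [perp_apply, sub_eq_zero, eq_comm, Submodule.starProjection_eq_self_iff]

lemma perp_perp (L : Submodule ℝ E) (x : E) : perp L (perp L x) = perp L x :=
  Submodule.starProjection_eq_self_iff.2 (Submodule.starProjection_apply_mem _ _)

lemma inner_perp_left (L : Submodule ℝ E) (x y : E) : ⟪perp L x, y⟫_ℝ = ⟪perp L x, perp L y⟫_ℝ := by
  conv_lhs => rw [← perp_perp]
  exact Submodule.inner_starProjection_left_eq_right _ _ _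

lemma inner_perp_right (L : Submodule ℝ E) (x y : E) :
    ⟪x, perp L y⟫_ℝ = ⟪perp L x, perp L y⟫_ℝ := by
  rw [real_inner_comm, inner_perp_left, real_inner_comm]

lemma norm_perp_le (L : Submodule ℝ E) (x : E) : ‖perp L x‖ ≤ ‖x‖ :=
  Submodule.norm_starProjection_apply_le _ _

lemma infDist_eq_norm_perp (L : Submodule ℝ E) (x : E) :
    Metric.infDist x (L : Set E) = ‖perp L x‖ := by
  have h := Submodule.starProjection_minimal (U := L) x
  rw [perp_apply, h, Metric.infDist_eq_iInf]
  simp [dist_eq_norm]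

lemma mem_tube_iff {σ : Submodule ℝ E → ℝ} {r : ℝ} {L : Submodule ℝ E} {x : E} :
    x ∈ tube σ r L ↔ ‖perp L x‖ ≤ σ L * r := by
  rw [tube, Set.mem_ofPred_eq, infDist_eq_norm_perp]

lemma mem_tubeWall_iff {σ : Submodule ℝ E → ℝ} {r : ℝ} {L : Submodule ℝ E} {x : E} :
    x ∈ tubeWall σ r L ↔ ‖perp L x‖ = σ L * r := by
  rw [tubeWall, Set.mem_ofPred_eq, infDist_eq_norm_perp]

lemma isClosed_tube (σ : Submodule ℝ E → ℝ) (r : ℝ) (L : Submodule ℝ E) :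
    IsClosed (tube σ r L) := by
  have : tube σ r L = {x | ‖perp L x‖ ≤ σ L * r} := by
    ext x
    exact mem_tube_iff
  rw [this]
  exact isClosed_le (by fun_prop) continuous_const

lemma unitNormal_eq (L : Submodule ℝ E) (x : E) : unitNormal L x = ‖perp L x‖⁻¹ • perp L x := by
  rw [unitNormal, perp_apply]

/-! ### Oriented lines and their reflection in a tube -/

/-- A pair `(x, v)` stands for the uniform motion `t ↦ x + t • v`. -/
def pos (s : E × E) (t : ℝ) : E := s.1 + t • s.2

/-- The reversed motion. -/
def rev (s : E × E) : E × E := (s.1, -s.2)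

/-- The motion with the time scaled by the factor `k`. -/
def scale (k : ℝ) (s : E × E) : E × E := (s.1, k • s.2)

/-- A quarter of the discriminant of the quadratic polynomial `‖perp L (pos s t)‖ ^ 2 - c ^ 2` in
`t`. It is positive if and only if the line meets the interior of the tube of radius `c` around `L`
in a bounded interval. -/
noncomputable def disc (L : Submodule ℝ E) (c : ℝ) (s : E × E) : ℝ :=
  ⟪perp L s.1, perp L s.2⟫_ℝ ^ 2 - ‖perp L s.2‖ ^ 2 * (‖perp L s.1‖ ^ 2 - c ^ 2)

/-- The time at which the line enters the tube of radius `c` around `L`; it has this meaning only if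
`0 < disc L c s`. -/
noncomputable def entryTime (L : Submodule ℝ E) (c : ℝ) (s : E × E) : ℝ :=
  (-⟪perp L s.1, perp L s.2⟫_ℝ - √(disc L c s)) / ‖perp L s.2‖ ^ 2

/-- The velocity after the reflection at the entry into the tube of radius `c` around `L`. -/
noncomputable def reflectVel (L : Submodule ℝ E) (c : ℝ) (s : E × E) : E :=
  s.2 + (2 * √(disc L c s) / c ^ 2) • perp L (pos s (entryTime L c s))

/-- The motion after the reflection at the entry into the tube of radius `c` around `L`, extended
to a full line: it agrees with `s` at the entry time. -/
noncomputable def reflectLine (L : Submodule ℝ E) (c : ℝ) (s : E × E) : E × E :=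
  (pos s (entryTime L c s) - entryTime L c s • reflectVel L c s, reflectVel L c s)

lemma pos_rev (s : E × E) (t : ℝ) : pos (rev s) t = pos s (-t) := by
  simp [pos, rev]

lemma rev_rev (s : E × E) : rev (rev s) = s := by simp [rev]

lemma pos_reflectLine (L : Submodule ℝ E) (c : ℝ) (s : E × E) :
    pos (reflectLine L c s) (entryTime L c s) = pos s (entryTime L c s) := by
  simp [pos, reflectLine]

lemma norm_perp_pos_sq (L : Submodule ℝ E) (s : E × E) (t : ℝ) :
    ‖perp L (pos s t)‖ ^ 2 =
      ‖perp L s.1‖ ^ 2 + 2 * t * ⟪perp L s.1, perp L s.2⟫_ℝ + t ^ 2 * ‖perp L s.2‖ ^ 2 := by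
  rw [pos, map_add, map_smul, norm_add_sq_real, norm_smul, inner_smul_right, mul_pow,
    Real.norm_eq_abs, sq_abs]
  ring

lemma inner_perp_pos (L : Submodule ℝ E) (s : E × E) (t : ℝ) :
    ⟪perp L (pos s t), perp L s.2⟫_ℝ = ⟪perp L s.1, perp L s.2⟫_ℝ + t * ‖perp L s.2‖ ^ 2 := by
  rw [pos, map_add, map_smul, inner_add_left, inner_smul_left, real_inner_self_eq_norm_sq]
  rfl

/-- The discriminant does not depend on the base point of the line. -/
lemma disc_eq_at (L : Submodule ℝ E) (c : ℝ) (s : E × E) (t : ℝ) :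
    disc L c s = ⟪perp L (pos s t), perp L s.2⟫_ℝ ^ 2
      - ‖perp L s.2‖ ^ 2 * (‖perp L (pos s t)‖ ^ 2 - c ^ 2) := by
  rw [disc, inner_perp_pos, norm_perp_pos_sq]
  ring

lemma disc_rev (L : Submodule ℝ E) (c : ℝ) (s : E × E) : disc L c (rev s) = disc L c s := by
  simp [disc, rev]

lemma disc_scale (L : Submodule ℝ E) (c k : ℝ) (s : E × E) :
    disc L c (scale k s) = k ^ 2 * disc L c s := by
  simp only [disc, scale, map_smul, norm_smul, inner_smul_right, mul_pow, Real.norm_eq_abs, sq_abs]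
  ring

lemma norm_perp_vel_pos {L : Submodule ℝ E} {c : ℝ} {s : E × E} (h : 0 < disc L c s) :
    0 < ‖perp L s.2‖ := by
  rw [norm_pos_iff]
  intro h0
  simp [disc, h0] at h

/-- A point where the line meets the boundary of the tube, moving inwards, is the entry point. -/
lemma entry_of_inner_neg {L : Submodule ℝ E} {c : ℝ} {s : E × E} {t : ℝ}
    (hw : ‖perp L (pos s t)‖ = c) (hi : ⟪perp L (pos s t), perp L s.2⟫_ℝ < 0) :
    0 < disc L c s ∧ entryTime L c s = t ∧
      √(disc L c s) = -⟪perp L (pos s t), perp L s.2⟫_ℝ := by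
  have hd : disc L c s = (-⟪perp L (pos s t), perp L s.2⟫_ℝ) ^ 2 := by
    rw [disc_eq_at L c s t, hw]
    ring
  have hs : √(disc L c s) = -⟪perp L (pos s t), perp L s.2⟫_ℝ := by
    rw [hd, Real.sqrt_sq (by linarith)]
  have hpos : 0 < disc L c s := by
    rw [hd]
    nlinarith
  refine ⟨hpos, ?_, hs⟩
  have hA := norm_perp_vel_pos hpos
  rw [entryTime, hs, inner_perp_pos]
  field_simp
  ring

lemma entry_spec {L : Submodule ℝ E} {c : ℝ} (hc : 0 < c) {s : E × E} (h : 0 < disc L c s) :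
    ‖perp L (pos s (entryTime L c s))‖ = c ∧
      ⟪perp L (pos s (entryTime L c s)), perp L s.2⟫_ℝ = -√(disc L c s) := by
  have hA := norm_perp_vel_pos h
  have h1 : ⟪perp L (pos s (entryTime L c s)), perp L s.2⟫_ℝ = -√(disc L c s) := by
    rw [inner_perp_pos, entryTime]
    field_simp
    ring
  refine ⟨?_, h1⟩
  have h2 := disc_eq_at L c s (entryTime L c s)
  rw [h1, neg_sq, Real.sq_sqrt h.le] at h2
  have h3 : ‖perp L (pos s (entryTime L c s))‖ ^ 2 - c ^ 2 = 0 := by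
    have : ‖perp L s.2‖ ^ 2 * (‖perp L (pos s (entryTime L c s))‖ ^ 2 - c ^ 2) = 0 := by linarith
    exact (mul_eq_zero.1 this).resolve_left (by positivity)
  exact (sq_eq_sq₀ (norm_nonneg _) hc.le).1 (by linarith)

lemma entry_inner_neg {L : Submodule ℝ E} {c : ℝ} (hc : 0 < c) {s : E × E}
    (h : 0 < disc L c s) : ⟪perp L (pos s (entryTime L c s)), perp L s.2⟫_ℝ < 0 := by
  rw [(entry_spec hc h).2]
  simpa using h

/-- After the reflection the motion leaves the tube. -/
lemma inner_perp_reflectVel {L : Submodule ℝ E} {c : ℝ} (hc : 0 < c) {s : E × E}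
    (h : 0 < disc L c s) :
    ⟪perp L (pos s (entryTime L c s)), perp L (reflectVel L c s)⟫_ℝ = √(disc L c s) := by
  obtain ⟨h1, h2⟩ := entry_spec hc h
  rw [reflectVel, map_add, map_smul, perp_perp, inner_add_right, inner_smul_right, h2,
    real_inner_self_eq_norm_sq, h1]
  field_simp
  ring

lemma norm_reflectVel {L : Submodule ℝ E} {c : ℝ} (hc : 0 < c) {s : E × E}
    (h : 0 < disc L c s) : ‖reflectVel L c s‖ = ‖s.2‖ := by
  obtain ⟨h1, h2⟩ := entry_spec hc h
  refine (sq_eq_sq₀ (norm_nonneg _) (norm_nonneg _)).1 ?_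
  rw [reflectVel, norm_add_sq_real, inner_smul_right, inner_perp_right, real_inner_comm, h2,
    norm_smul, mul_pow, h1, Real.norm_eq_abs, sq_abs]
  field_simp
  ring

lemma reflectLine_eq {L : Submodule ℝ E} {c : ℝ} {s : E × E} {t : ℝ} {v : E}
    (hw : ‖perp L (pos s t)‖ = c) (hi : ⟪perp L (pos s t), perp L s.2⟫_ℝ < 0)
    (hv : v = s.2 - (2 * ⟪perp L (pos s t), perp L s.2⟫_ℝ / c ^ 2) • perp L (pos s t)) :
    reflectLine L c s = (pos s t - t • v, v) := by
  obtain ⟨-, h2, h3⟩ := entry_of_inner_neg hw hi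
  have : reflectVel L c s = v := by
    rw [reflectVel, h3, h2, hv, sub_eq_add_neg, ← neg_smul]
    congr 2
    ring
  rw [reflectLine, this, h2]

/-- Reversibility: reflecting the reversed reflected motion gives the reversed motion. -/
lemma reflectLine_rev_reflectLine {L : Submodule ℝ E} {c : ℝ} (hc : 0 < c) {s : E × E}
    (h : 0 < disc L c s) :
    0 < disc L c (reflectLine L c s) ∧
      reflectLine L c (rev (reflectLine L c s)) = rev s := by
  set t := entryTime L c s with ht
  obtain ⟨h1, h2⟩ := entry_spec hc h
  have h3 := inner_perp_reflectVel hc h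
  have hp : pos (rev (reflectLine L c s)) (-t) = pos s t := by
    rw [pos_rev, neg_neg, ht, pos_reflectLine]
  have hv : (rev (reflectLine L c s)).2 = -reflectVel L c s := rfl
  have hi : ⟪perp L (pos (rev (reflectLine L c s)) (-t)), perp L (rev (reflectLine L c s)).2⟫_ℝ
      = -√(disc L c s) := by
    rw [hp, hv, map_neg, inner_neg_right, h3]
  have hs : 0 < √(disc L c s) := Real.sqrt_pos.2 h
  have hw : ‖perp L (pos (rev (reflectLine L c s)) (-t))‖ = c := by rw [hp, h1]
  have hi' := hi.trans_lt (neg_neg_of_pos hs)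
  refine ⟨by simpa [disc_rev] using (entry_of_inner_neg hw hi').1, ?_⟩
  rw [reflectLine_eq (v := -s.2) hw hi', hp]
  · simp [rev, pos]
  · rw [hi, hp, hv, reflectVel, ← ht]
    simp only [mul_neg, neg_div, neg_smul, sub_neg_eq_add]
    abel

lemma reflectLine_scale {L : Submodule ℝ E} {c : ℝ} (hc : 0 < c) {s : E × E} {k : ℝ} (hk : 0 < k)
    (h : 0 < disc L c s) : reflectLine L c (scale k s) = scale k (reflectLine L c s) := by
  obtain ⟨h1, h2⟩ := entry_spec hc h
  set t := entryTime L c s with ht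
  have hp : pos (scale k s) (t / k) = pos s t := by
    simp only [pos, scale, smul_smul]
    rw [div_mul_cancel₀ _ hk.ne']
  have hs : 0 < √(disc L c s) := Real.sqrt_pos.2 h
  have hi : ⟪perp L (pos (scale k s) (t / k)), perp L (scale k s).2⟫_ℝ = -(k * √(disc L c s)) := by
    rw [hp, scale, map_smul, inner_smul_right, h2]
    ring
  rw [reflectLine_eq (t := t / k) (v := k • reflectVel L c s) (by rw [hp, h1])
    (by rw [hi]; exact neg_neg_of_pos (by positivity)), hp]
  · simp only [scale, reflectLine, smul_smul, ← ht]
    rw [div_mul_cancel₀ _ hk.ne']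
  · rw [hi, hp, scale, reflectVel, ← ht, smul_add, smul_smul, sub_eq_add_neg, ← neg_smul]
    congr 2
    ring

lemma continuous_disc (L : Submodule ℝ E) (c : ℝ) : Continuous (disc L c) := by
  unfold disc
  fun_prop

lemma continuousAt_entryTime {L : Submodule ℝ E} {c : ℝ} {s : E × E} (h : 0 < disc L c s) :
    ContinuousAt (entryTime L c) s := by
  have hA := norm_perp_vel_pos h
  have := (continuous_disc L c).sqrt
  unfold entryTime
  refine ContinuousAt.div ?_ (by fun_prop) (by positivity)
  exact (Continuous.sub (by fun_prop) this).continuousAt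

lemma continuousAt_reflectLine {L : Submodule ℝ E} {c : ℝ} {s : E × E} (h : 0 < disc L c s) :
    ContinuousAt (reflectLine L c) s := by
  have h1 := continuousAt_entryTime h
  have h2 : ContinuousAt (fun s => √(disc L c s)) s := (continuous_disc L c).sqrt.continuousAt
  have h3 : ContinuousAt (fun s => pos s (entryTime L c s)) s := by
    unfold pos
    fun_prop
  have h4 : ContinuousAt (reflectVel L c) s := by
    unfold reflectVel
    have : ContinuousAt (fun s => perp L (pos s (entryTime L c s))) s :=
      (perp L).continuous.continuousAt.comp h3
    fun_prop
  unfold reflectLine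
  fun_prop

/-- Once a motion leaves a tube it stays outside. -/
lemma lt_norm_perp_of_exit {L : Submodule ℝ E} {s : E × E} {t₀ t : ℝ} (ht : t₀ < t)
    (hi : 0 < ⟪perp L (pos s t₀), perp L s.2⟫_ℝ) :
    ‖perp L (pos s t₀)‖ < ‖perp L (pos s t)‖ := by
  refine lt_of_pow_lt_pow_left₀ 2 (norm_nonneg _) ?_
  rw [inner_perp_pos] at hi
  rw [norm_perp_pos_sq, norm_perp_pos_sq]
  nlinarith [sq_nonneg ((t - t₀) * ‖perp L s.2‖), mul_pos (sub_pos.2 ht) hi]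

/-- Before a motion enters a tube it is outside. -/
lemma lt_norm_perp_of_entry {L : Submodule ℝ E} {s : E × E} {t₀ t : ℝ} (ht : t < t₀)
    (hi : ⟪perp L (pos s t₀), perp L s.2⟫_ℝ < 0) :
    ‖perp L (pos s t₀)‖ < ‖perp L (pos s t)‖ := by
  refine lt_of_pow_lt_pow_left₀ 2 (norm_nonneg _) ?_
  rw [inner_perp_pos] at hi
  rw [norm_perp_pos_sq, norm_perp_pos_sq]
  nlinarith [sq_nonneg ((t - t₀) * ‖perp L s.2‖), mul_pos (sub_pos.2 ht) (neg_pos.2 hi)]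

/-! ### Generic lines -/

/-- The resultant of the two quadratic polynomials `‖perp L (pos s t)‖ ^ 2 - c ^ 2` and
`‖perp L' (pos s t)‖ ^ 2 - c' ^ 2` in `t`. -/
noncomputable def res (L : Submodule ℝ E) (c : ℝ) (L' : Submodule ℝ E) (c' : ℝ) (s : E × E) : ℝ :=
  (‖perp L s.2‖ ^ 2 * (‖perp L' s.1‖ ^ 2 - c' ^ 2)
      - ‖perp L' s.2‖ ^ 2 * (‖perp L s.1‖ ^ 2 - c ^ 2)) ^ 2
    - 4 * (‖perp L s.2‖ ^ 2 * ⟪perp L' s.1, perp L' s.2⟫_ℝ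
        - ‖perp L' s.2‖ ^ 2 * ⟪perp L s.1, perp L s.2⟫_ℝ)
      * (⟪perp L s.1, perp L s.2⟫_ℝ * (‖perp L' s.1‖ ^ 2 - c' ^ 2)
        - ⟪perp L' s.1, perp L' s.2⟫_ℝ * (‖perp L s.1‖ ^ 2 - c ^ 2))

lemma res_eq_zero {L L' : Submodule ℝ E} {c c' : ℝ} {s : E × E} {t : ℝ}
    (h : ‖perp L (pos s t)‖ = c) (h' : ‖perp L' (pos s t)‖ = c') : res L c L' c' s = 0 := by
  have e := norm_perp_pos_sq L s t
  have e' := norm_perp_pos_sq L' s t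
  rw [h] at e
  rw [h'] at e'
  unfold res
  generalize ‖perp L s.1‖ ^ 2 = x at *
  generalize ‖perp L' s.1‖ ^ 2 = x' at *
  generalize ‖perp L s.2‖ ^ 2 = a at *
  generalize ‖perp L' s.2‖ ^ 2 = a' at *
  generalize ⟪perp L s.1, perp L s.2⟫_ℝ = b at *
  generalize ⟪perp L' s.1, perp L' s.2⟫_ℝ = b' at *
  have h1 : x - c ^ 2 = -(2 * t * b + t ^ 2 * a) := by linarith
  have h2 : x' - c' ^ 2 = -(2 * t * b' + t ^ 2 * a') := by linarith
  rw [h1, h2]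
  ring

lemma res_scale (L L' : Submodule ℝ E) (c c' k : ℝ) (s : E × E) :
    res L c L' c' (scale k s) = k ^ 4 * res L c L' c' s := by
  simp only [res, scale, map_smul, norm_smul, inner_smul_right, mul_pow, Real.norm_eq_abs, sq_abs]
  ring

lemma isOpen_dense_ne_zero {f : E × E → ℝ} (hf : ContDiff ℝ ω f) {s₀ : E × E} (h : f s₀ ≠ 0) :
    IsOpen {s | f s ≠ 0} ∧ Dense {s | f s ≠ 0} := by
  refine ⟨isOpen_ne_fun hf.continuous continuous_const, ?_⟩
  rw [dense_iff_inter_open]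
  rintro U hU ⟨z, hz⟩
  by_contra hne
  have hz0 : f =ᶠ[𝓝 z] fun _ => 0 := by
    filter_upwards [hU.mem_nhds hz] with y hy
    by_contra hfy
    exact hne ⟨y, hy, hfy⟩
  have ha : AnalyticOnNhd ℝ f Set.univ := contDiff_omega_iff_analyticOnNhd.1 hf
  exact h (congrFun (ha.eq_of_eventuallyEq (fun x _ => analyticAt_const) hz0) s₀)

lemma contDiff_disc (L : Submodule ℝ E) (c : ℝ) : ContDiff ℝ ω (disc L c) := by
  have h1 : ContDiff ℝ ω fun s : E × E => ⟪perp L s.1, perp L s.2⟫_ℝ :=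
    ContDiff.inner ℝ (by fun_prop) (by fun_prop)
  have h2 : ContDiff ℝ ω fun s : E × E => ‖perp L s.2‖ ^ 2 := ContDiff.norm_sq ℝ (by fun_prop)
  have h3 : ContDiff ℝ ω fun s : E × E => ‖perp L s.1‖ ^ 2 := ContDiff.norm_sq ℝ (by fun_prop)
  unfold disc
  fun_prop

lemma contDiff_res (L L' : Submodule ℝ E) (c c' : ℝ) : ContDiff ℝ ω (res L c L' c') := by
  have h1 : ∀ L : Submodule ℝ E, ContDiff ℝ ω fun s : E × E => ⟪perp L s.1, perp L s.2⟫_ℝ :=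
    fun L => ContDiff.inner ℝ (by fun_prop) (by fun_prop)
  have h2 : ∀ L : Submodule ℝ E, ContDiff ℝ ω fun s : E × E => ‖perp L s.2‖ ^ 2 :=
    fun L => ContDiff.norm_sq ℝ (by fun_prop)
  have h3 : ∀ L : Submodule ℝ E, ContDiff ℝ ω fun s : E × E => ‖perp L s.1‖ ^ 2 :=
    fun L => ContDiff.norm_sq ℝ (by fun_prop)
  have := h1 L
  have := h1 L'
  have := h2 L
  have := h2 L'
  have := h3 L
  have := h3 L'
  unfold res
  fun_prop

lemma exists_disc_ne_zero {L : Submodule ℝ E} (hL : L ≠ ⊤) {c : ℝ} (hc : 0 < c) :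
    ∃ s, disc L c s ≠ 0 := by
  obtain ⟨v, -, hv⟩ := SetLike.exists_of_lt (lt_top_iff_ne_top.2 hL)
  have hv' : ‖perp L v‖ ≠ 0 := by
    rw [norm_ne_zero_iff]
    exact fun h => hv (perp_eq_zero_iff.1 h)
  exact ⟨(0, v), by simp [disc, hv', hc.ne']⟩

lemma exists_res_ne_zero {L L' : Submodule ℝ E} (hL : L ≠ L') {c c' : ℝ} (hc : 0 < c)
    (hc' : 0 < c') : ∃ s, res L c L' c' s ≠ 0 := by
  -- A line through the origin along one of the subspaces and transverse to the other one.
  have key : ∃ v, (v ∈ L ∧ v ∉ L') ∨ (v ∈ L' ∧ v ∉ L) := by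
    by_contra! h
    exact hL (le_antisymm (fun v hv => (h v).1 hv) fun v hv => (h v).2 hv)
  obtain ⟨v, ⟨h1, h2⟩ | ⟨h1, h2⟩⟩ := key
  all_goals
    rw [← perp_eq_zero_iff] at h1 h2
    exact ⟨(0, v), by simp [res, h1, h2, hc.ne', hc'.ne']⟩

/-- Regularity of a line, stated by the nonvanishing of polynomials in the line. It implies that the
line is not tangent to any tube and does not meet the walls of two tubes at the same point. -/
def IsRegular (𝓛 : Finset (Submodule ℝ E)) (σ : Submodule ℝ E → ℝ) (r : ℝ) (s : E × E) : Prop :=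
  (∀ L ∈ 𝓛, disc L (σ L * r) s ≠ 0) ∧
    ∀ L ∈ 𝓛, ∀ L' ∈ 𝓛, L ≠ L' → res L (σ L * r) L' (σ L' * r) s ≠ 0

/-- A line is generic for the list of subspaces `w` if the successive reflections in the tubes
around the members of `w` lead to a regular line, provided that the reflected lines do meet these
tubes. -/
def IsGenericFor (𝓛 : Finset (Submodule ℝ E)) (σ : Submodule ℝ E → ℝ) (r : ℝ) :
    List (Submodule ℝ E) → E × E → Prop
  | [], s => IsRegular 𝓛 σ r s
  | L :: w, s => 0 < disc L (σ L * r) s → IsGenericFor 𝓛 σ r w (reflectLine L (σ L * r) s)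

/-- A line is generic if any sequence of reflections in tubes around members of `𝓛` leads to a
regular line. -/
def IsGeneric (𝓛 : Finset (Submodule ℝ E)) (σ : Submodule ℝ E → ℝ) (r : ℝ) (s : E × E) : Prop :=
  ∀ w : List 𝓛, IsGenericFor 𝓛 σ r (w.map (↑)) s

variable {𝓛 : Finset (Submodule ℝ E)} {σ : Submodule ℝ E → ℝ} {r : ℝ}

lemma IsGeneric.isRegular {s : E × E} (h : IsGeneric 𝓛 σ r s) : IsRegular 𝓛 σ r s := h []

lemma IsGeneric.reflectLine {s : E × E} (h : IsGeneric 𝓛 σ r s) {L : Submodule ℝ E} (hL : L ∈ 𝓛)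
    (hd : 0 < disc L (σ L * r) s) : IsGeneric 𝓛 σ r (reflectLine L (σ L * r) s) :=
  fun w => h (⟨L, hL⟩ :: w) hd

lemma IsRegular.scale {s : E × E} (h : IsRegular 𝓛 σ r s) {k : ℝ} (hk : 0 < k) :
    IsRegular 𝓛 σ r (scale k s) := by
  refine ⟨fun L hL => ?_, fun L hL L' hL' hne => ?_⟩
  · rw [disc_scale]
    exact mul_ne_zero (by positivity) (h.1 L hL)
  · rw [res_scale]
    exact mul_ne_zero (by positivity) (h.2 L hL L' hL' hne)

lemma IsGeneric.scale (hσ : ∀ L ∈ 𝓛, 0 < σ L * r) {s : E × E} (h : IsGeneric 𝓛 σ r s) {k : ℝ}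
    (hk : 0 < k) : IsGeneric 𝓛 σ r (scale k s) := by
  intro w
  replace h := h w
  induction w generalizing s with
  | nil => exact IsRegular.scale h hk
  | cons L w ih =>
    intro hd
    rw [disc_scale] at hd
    have hd' := pos_of_mul_pos_right hd (by positivity)
    rw [reflectLine_scale (hσ L L.2) hk hd']
    exact ih (h hd')

lemma isOpen_dense_isRegular (hσ : ∀ L ∈ 𝓛, 0 < σ L * r) (htop : ∀ L ∈ 𝓛, L ≠ ⊤) :
    IsOpen {s | IsRegular 𝓛 σ r s} ∧ Dense {s | IsRegular 𝓛 σ r s} := by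
  have e : {s | IsRegular 𝓛 σ r s} = (⋂ L : 𝓛, {s | disc L.1 (σ L * r) s ≠ 0}) ∩
      ⋂ p : {p : 𝓛 × 𝓛 // p.1 ≠ p.2},
        {s | res p.1.1.1 (σ p.1.1 * r) p.1.2.1 (σ p.1.2 * r) s ≠ 0} := by
    ext s
    simp [IsRegular]
  have h1 (L : 𝓛) : IsOpen {s | disc L.1 (σ L * r) s ≠ 0} ∧ Dense {s | disc L.1 (σ L * r) s ≠ 0} :=
    have ⟨_, h⟩ := exists_disc_ne_zero (htop L L.2) (hσ L L.2)
    isOpen_dense_ne_zero (contDiff_disc _ _) h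
  have h2 (p : {p : 𝓛 × 𝓛 // p.1 ≠ p.2}) :
      IsOpen {s | res p.1.1.1 (σ p.1.1 * r) p.1.2.1 (σ p.1.2 * r) s ≠ 0} ∧
        Dense {s | res p.1.1.1 (σ p.1.1 * r) p.1.2.1 (σ p.1.2 * r) s ≠ 0} :=
    have ⟨_, h⟩ := exists_res_ne_zero (fun h => p.2 (Subtype.ext h)) (hσ _ p.1.1.2) (hσ _ p.1.2.2)
    isOpen_dense_ne_zero (contDiff_res _ _ _ _) h
  have o1 := isOpen_iInter_of_finite fun L => (h1 L).1
  have o2 := isOpen_iInter_of_finite fun p => (h2 p).1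
  rw [e]
  have d1 := dense_iInter_of_isOpen (fun L => (h1 L).1) fun L => (h1 L).2
  exact ⟨o1.inter o2, d1.inter_of_isOpen_left
    (dense_iInter_of_isOpen (fun p => (h2 p).1) fun p => (h2 p).2) o1⟩

/-- Reflection is an open map where it is defined, being invertible with continuous inverse. Hence
open dense sets pull back to sets containing an open dense set. -/
lemma exists_isOpen_dense_reflectLine {L : Submodule ℝ E} {c : ℝ} (hc : 0 < c) {V : Set (E × E)}
    (ho : IsOpen V) (hd : Dense V) :
    ∃ U, IsOpen U ∧ Dense U ∧ ∀ s ∈ U, 0 < disc L c s → reflectLine L c s ∈ V := by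
  set D : Set (E × E) := {s | 0 < disc L c s} with hD
  have hDo : IsOpen D := isOpen_lt continuous_const (continuous_disc L c)
  have hcont : ContinuousOn (reflectLine L c) D :=
    fun s hs => (continuousAt_reflectLine hs).continuousWithinAt
  have hrev : Continuous (rev : E × E → E × E) := by
    unfold rev
    fun_prop
  refine ⟨(D ∩ reflectLine L c ⁻¹' V) ∪ (closure D)ᶜ,
    (hcont.isOpen_inter_preimage hDo ho).union isClosed_closure.isOpen_compl, ?_, ?_⟩
  · rw [dense_iff_inter_open]
    rintro W hW ⟨z, hz⟩
    by_cases hzD : z ∈ closure D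
    · obtain ⟨y, hyW, hyD⟩ := mem_closure_iff.1 hzD W hW hz
      have hmaps : ∀ s ∈ D, rev s ∈ D := fun s hs => by
        rw [hD, Set.mem_ofPred_eq, disc_rev]
        exact hs
      have hinv : ContinuousOn (fun s => rev (reflectLine L c (rev s))) D :=
        hrev.comp_continuousOn (hcont.comp hrev.continuousOn hmaps)
      have hopen := hinv.isOpen_inter_preimage hDo (hDo.inter hW)
      have hy := reflectLine_rev_reflectLine hc hyD
      obtain ⟨x, ⟨hxD, hxD', hxW⟩, hxV⟩ := hd.inter_open_nonempty _ hopen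
        ⟨reflectLine L c y, hy.1, by
          rw [Set.mem_preimage, hy.2, rev_rev]
          exact ⟨hyD, hyW⟩⟩
      refine ⟨_, hxW, Or.inl ⟨hxD', ?_⟩⟩
      rw [Set.mem_preimage, (reflectLine_rev_reflectLine hc (hmaps x hxD)).2, rev_rev]
      exact hxV
    · exact ⟨z, hz, Or.inr hzD⟩
  · rintro s (hs | hs) hsD
    · exact hs.2
    · exact absurd (subset_closure (show s ∈ D from hsD)) hs

lemma exists_isOpen_dense_isGenericFor (hσ : ∀ L ∈ 𝓛, 0 < σ L * r) (htop : ∀ L ∈ 𝓛, L ≠ ⊤)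
    (w : List 𝓛) :
    ∃ U, IsOpen U ∧ Dense U ∧ ∀ s ∈ U, IsGenericFor 𝓛 σ r (w.map (↑)) s := by
  induction w with
  | nil =>
    obtain ⟨h1, h2⟩ := isOpen_dense_isRegular hσ htop
    exact ⟨_, h1, h2, fun s hs => hs⟩
  | cons L w ih =>
    obtain ⟨V, ho, hd, hV⟩ := ih
    obtain ⟨U, ho', hd', hU⟩ := exists_isOpen_dense_reflectLine (L := L.1) (hσ L L.2) ho hd
    exact ⟨U, ho', hd', fun s hs h => hV _ (hU s hs h)⟩

/-- By Baire's theorem, the lines that are generic both in the future and in the past are dense. -/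
lemma dense_isGeneric (hσ : ∀ L ∈ 𝓛, 0 < σ L * r) (htop : ∀ L ∈ 𝓛, L ≠ ⊤) :
    Dense {s | IsGeneric 𝓛 σ r s ∧ IsGeneric 𝓛 σ r (rev s)} := by
  choose U ho hd hU using exists_isOpen_dense_isGenericFor hσ htop
  have hrev : Continuous (rev : E × E → E × E) := by
    unfold rev
    fun_prop
  have h1 : Dense (⋂ w, U w ∩ rev ⁻¹' U w) := by
    let R : E × E ≃ₜ E × E := ⟨⟨rev, rev, rev_rev, rev_rev⟩, hrev, hrev⟩
    refine dense_iInter_of_isOpen (fun w => (ho w).inter ((ho w).preimage hrev)) fun w => ?_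
    exact (hd w).inter_of_isOpen_left ((hd w).preimage R.isOpenMap) (ho w)
  refine h1.mono fun s hs => ⟨fun w => hU w s ?_, fun w => hU w _ ?_⟩
  · exact (Set.mem_iInter.1 hs w).1
  · exact (Set.mem_iInter.1 hs w).2

/-! ### Collisions with tubes and the steps of a thickened trajectory -/

/-- The relation between the velocities `v₁` before and `v₂` after the passage through `p` in a
thickened trajectory: no change outside of the tubes, and reflection at the walls. -/
def CollisionLaw (𝓛 : Finset (Submodule ℝ E)) (σ : Submodule ℝ E → ℝ) (r : ℝ) (p v₁ v₂ : E) :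
    Prop :=
  ((∀ L ∈ 𝓛, p ∉ tube σ r L) → v₂ = v₁) ∧
    (∀ L ∈ 𝓛, p ∈ tube σ r L →
      p ∈ tubeWall σ r L ∧ (∀ L' ∈ 𝓛, L' ≠ L → p ∉ tube σ r L') ∧
      inner ℝ v₁ (unitNormal L p) < 0 ∧
      v₂ = v₁ - (2 * inner ℝ v₁ (unitNormal L p)) • unitNormal L p)

/-- Near the time `t` the curve `q` is a thickened trajectory with the velocities `v₁` before and
`v₂` after `t`. -/
def MovesAt (𝓛 : Finset (Submodule ℝ E)) (σ : Submodule ℝ E → ℝ) (r : ℝ) (q : ℝ → E) (t : ℝ)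
    (v₁ v₂ : E) : Prop :=
  HasVelocityBefore q t v₁ ∧ HasVelocityAfter q t v₂ ∧ ‖v₁‖ = 1 ∧ ‖v₂‖ = 1 ∧
    CollisionLaw 𝓛 σ r (q t) v₁ v₂

lemma collisionLaw_self {p : E} (h : ∀ L ∈ 𝓛, p ∉ tube σ r L) (v : E) :
    CollisionLaw 𝓛 σ r p v v :=
  ⟨fun _ => rfl, fun L hL hp => absurd hp (h L hL)⟩

lemma CollisionLaw.rev {p v₁ v₂ : E} (h : CollisionLaw 𝓛 σ r p v₁ v₂) :
    CollisionLaw 𝓛 σ r p (-v₂) (-v₁) := by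
  refine ⟨fun hf => by rw [h.1 hf], fun L hL hp => ?_⟩
  obtain ⟨h1, h2, h3, h4⟩ := h.2 L hL hp
  have hn : ‖unitNormal L p‖ = 1 := by
    rw [unitNormal, norm_smul, norm_inv, norm_norm]
    refine inv_mul_cancel₀ fun h0 => ?_
    rw [unitNormal, norm_eq_zero.1 h0] at h3
    simp at h3
  have h5 : ⟪v₂, unitNormal L p⟫_ℝ = -⟪v₁, unitNormal L p⟫_ℝ := by
    rw [h4, inner_sub_left, inner_smul_left, real_inner_self_eq_norm_sq, hn]
    simp only [conj_trivial]
    ring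
  refine ⟨h1, h2, ?_, ?_⟩
  · rwa [inner_neg_left, h5, neg_neg]
  · rw [inner_neg_left, h5, neg_neg, h4]
    module

/-- The tubes are convex: a collision turns the velocity away from every point `x` of the tube. -/
lemma CollisionLaw.inner_sub_le {p v₁ v₂ x : E} (h : CollisionLaw 𝓛 σ r p v₁ v₂)
    (hx : ∀ L ∈ 𝓛, p ∈ tube σ r L → x ∈ tube σ r L) : ⟪p - x, v₁⟫_ℝ ≤ ⟪p - x, v₂⟫_ℝ := by
  by_cases hf : ∀ L ∈ 𝓛, p ∉ tube σ r L
  · rw [h.1 hf]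
  push Not at hf
  obtain ⟨L, hL, hp⟩ := hf
  obtain ⟨h1, -, h3, h4⟩ := h.2 L hL hp
  have hxp := mem_tube_iff.1 (hx L hL hp)
  rw [mem_tubeWall_iff] at h1
  have h5 : 0 ≤ ⟪p - x, perp L p⟫_ℝ := by
    rw [inner_perp_right, map_sub, inner_sub_left, real_inner_self_eq_norm_sq]
    have := real_inner_le_norm (perp L x) (perp L p)
    nlinarith [norm_nonneg (perp L x), norm_nonneg (perp L p)]
  have h6 : 0 ≤ ⟪p - x, unitNormal L p⟫_ℝ := by
    rw [unitNormal_eq, inner_smul_right]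
    positivity
  rw [h4, inner_sub_right, inner_smul_right]
  nlinarith

lemma collisionLaw_reflectVel {L : Submodule ℝ E} (hσ : 0 < σ L * r) {s : E × E}
    (hd : 0 < disc L (σ L * r) s)
    (ho : ∀ L' ∈ 𝓛, L' ≠ L → pos s (entryTime L (σ L * r) s) ∉ tube σ r L') (hL : L ∈ 𝓛) :
    CollisionLaw 𝓛 σ r (pos s (entryTime L (σ L * r) s)) s.2 (reflectVel L (σ L * r) s) := by
  obtain ⟨h1, h2⟩ := entry_spec hσ hd
  set p := pos s (entryTime L (σ L * r) s) with hp
  have hn : ⟪s.2, unitNormal L p⟫_ℝ = -√(disc L (σ L * r) s) / (σ L * r) := by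
    rw [unitNormal_eq, inner_smul_right, inner_perp_right, real_inner_comm, h2, h1]
    ring
  refine ⟨fun h => absurd (mem_tube_iff.2 h1.le) (h L hL), fun L' hL' hp' => ?_⟩
  obtain rfl : L' = L := by
    by_contra hne
    exact ho L' hL' hne hp'
  refine ⟨mem_tubeWall_iff.2 h1, ho, ?_, ?_⟩
  · rw [hn, neg_div]
    exact neg_neg_of_pos (div_pos (Real.sqrt_pos.2 hd) hσ)
  · rw [hn, unitNormal_eq, reflectVel, ← hp, h1, smul_smul, sub_eq_add_neg, ← neg_smul]
    congr 2
    field_simp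

/-- A step of a thickened trajectory: free motion along `s` between the times `τ` and `τ'`, where
the motion goes over into `s'`. -/
structure IsStep (𝓛 : Finset (Submodule ℝ E)) (σ : Submodule ℝ E → ℝ) (r : ℝ) (s : E × E) (τ : ℝ)
    (s' : E × E) (τ' : ℝ) : Prop where
  lt : τ < τ'
  pos_eq : pos s τ' = pos s' τ'
  free : ∀ t ∈ Set.Ioo τ τ', ∀ L ∈ 𝓛, pos s t ∉ tube σ r L
  law : CollisionLaw 𝓛 σ r (pos s τ') s.2 s'.2
  norm_eq : ‖s'.2‖ = ‖s.2‖

/-- At time `τ` the motion `s` is outside of each tube or leaving it. -/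
def IsOutgoing (𝓛 : Finset (Submodule ℝ E)) (σ : Submodule ℝ E → ℝ) (r : ℝ) (s : E × E)
    (τ : ℝ) : Prop :=
  ∀ L ∈ 𝓛, σ L * r < ‖perp L (pos s τ)‖ ∨
    ‖perp L (pos s τ)‖ = σ L * r ∧ 0 < ⟪perp L (pos s τ), perp L s.2⟫_ℝ

/-- A regular outgoing motion can be in a tube at a later time only after entering it. -/
lemma entryTime_of_mem_tube {s : E × E} {τ t : ℝ} {L : Submodule ℝ E} (hL : L ∈ 𝓛)
    (hr : IsRegular 𝓛 σ r s) (ho : IsOutgoing 𝓛 σ r s τ) (ht : τ < t) (hm : pos s t ∈ tube σ r L) :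
    0 < disc L (σ L * r) s ∧ τ < entryTime L (σ L * r) s ∧ entryTime L (σ L * r) s ≤ t := by
  rw [mem_tube_iff] at hm
  rcases ho L hL with h | ⟨h, hi⟩
  · have hc : 0 ≤ σ L * r := (norm_nonneg _).trans hm
    have et := disc_eq_at L (σ L * r) s t
    have eτ := disc_eq_at L (σ L * r) s τ
    rw [inner_perp_pos] at et eτ
    have hd0 : (⟪perp L s.1, perp L s.2⟫_ℝ + t * ‖perp L s.2‖ ^ 2) ^ 2 ≤ disc L (σ L * r) s := by
      have : ‖perp L (pos s t)‖ ^ 2 ≤ (σ L * r) ^ 2 := by gcongr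
      nlinarith [sq_nonneg ‖perp L s.2‖]
    have hd : 0 < disc L (σ L * r) s :=
      lt_of_le_of_ne ((sq_nonneg _).trans hd0) (hr.1 L hL).symm
    have hA := norm_perp_vel_pos hd
    have hd1 : disc L (σ L * r) s < (⟪perp L s.1, perp L s.2⟫_ℝ + τ * ‖perp L s.2‖ ^ 2) ^ 2 := by
      have : (σ L * r) ^ 2 < ‖perp L (pos s τ)‖ ^ 2 := by gcongr
      have hA2 : 0 < ‖perp L s.2‖ ^ 2 := by positivity
      nlinarith
    have hA2 : 0 < ‖perp L s.2‖ ^ 2 := by positivity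
    obtain ⟨h1, h2⟩ := abs_le.1 (Real.abs_le_sqrt hd0)
    have h3 := (Real.sqrt_lt_sqrt hd.le hd1).trans_eq (Real.sqrt_sq_eq_abs _)
    have h4 : τ * ‖perp L s.2‖ ^ 2 < t * ‖perp L s.2‖ ^ 2 := by gcongr
    refine ⟨hd, ?_, ?_⟩
    · rw [entryTime, lt_div_iff₀ hA2]
      rcases lt_abs.1 h3 with h5 | h5 <;> linarith
    · rw [entryTime, div_le_iff₀ hA2]
      linarith
  · exact absurd (lt_norm_perp_of_exit ht hi) (by rw [h]; exact hm.not_gt)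

/-- A generic outgoing motion can be continued by a collision, or by a free flight of length `1`. -/
lemma exists_isStep (hσ : ∀ L ∈ 𝓛, 0 < σ L * r) {s : E × E} {τ : ℝ} (hg : IsGeneric 𝓛 σ r s)
    (ho : IsOutgoing 𝓛 σ r s τ) :
    ∃ s' τ', IsStep 𝓛 σ r s τ s' τ' ∧ IsGeneric 𝓛 σ r s' ∧ IsOutgoing 𝓛 σ r s' τ' ∧
      (s'.2 = s.2 → τ' = τ + 1) := by
  classical
  set H := 𝓛.filter fun L => 0 < disc L (σ L * r) s ∧ τ < entryTime L (σ L * r) s ∧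
    entryTime L (σ L * r) s ≤ τ + 1 with hH
  have hmemH : ∀ t, τ < t → t ≤ τ + 1 → ∀ L ∈ 𝓛, pos s t ∈ tube σ r L → L ∈ H ∧
      entryTime L (σ L * r) s ≤ t := by
    intro t ht ht' L hL hm
    obtain ⟨h1, h2, h3⟩ := entryTime_of_mem_tube hL hg.isRegular ho ht hm
    exact ⟨Finset.mem_filter.2 ⟨hL, h1, h2, h3.trans ht'⟩, h3⟩
  rcases H.eq_empty_or_nonempty with hem | hne
  · have hfree : ∀ t, τ < t → t ≤ τ + 1 → ∀ L ∈ 𝓛, pos s t ∉ tube σ r L := by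
      intro t ht ht' L hL hm
      simpa [hem] using (hmemH t ht ht' L hL hm).1
    have hend := hfree (τ + 1) (by linarith) le_rfl
    refine ⟨s, τ + 1, ⟨by linarith, rfl, fun t ht => hfree t ht.1 ht.2.le,
      collisionLaw_self hend _, rfl⟩, hg, fun L hL => Or.inl ?_, fun _ => rfl⟩
    have := hend L hL
    rwa [mem_tube_iff, not_le] at this
  · obtain ⟨L, hLH, hmin⟩ := H.exists_min_image (fun L => entryTime L (σ L * r) s) hne
    obtain ⟨hL, hd, hτ, hτ'⟩ := Finset.mem_filter.1 hLH
    have hcL := hσ L hL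
    obtain ⟨h1, h2⟩ := entry_spec hcL hd
    have h3 := inner_perp_reflectVel hcL hd
    have hpe := pos_reflectLine L (σ L * r) s
    have hs : 0 < √(disc L (σ L * r) s) := Real.sqrt_pos.2 hd
    set τ' := entryTime L (σ L * r) s with hτ'_def
    have hother : ∀ L' ∈ 𝓛, L' ≠ L → pos s τ' ∉ tube σ r L' := by
      intro L' hL' hne hm
      obtain ⟨hLH', hle⟩ := hmemH τ' hτ hτ' L' hL' hm
      have heq : entryTime L' (σ L' * r) s = τ' := le_antisymm hle (hmin L' hLH')
      obtain ⟨-, hd', -, -⟩ := Finset.mem_filter.1 hLH'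
      have h1' := (entry_spec (hσ L' hL') hd').1
      rw [heq] at h1'
      exact hg.isRegular.2 L' hL' L hL hne (res_eq_zero h1' h1)
    refine ⟨reflectLine L (σ L * r) s, τ', ⟨hτ, hpe.symm, ?_,
      collisionLaw_reflectVel hcL hd hother hL, norm_reflectVel hcL hd⟩, hg.reflectLine hL hd,
      fun L' hL' => ?_, fun heq => ?_⟩
    · intro t ht L' hL' hm
      obtain ⟨hLH', hle⟩ := hmemH t ht.1 (ht.2.le.trans hτ') L' hL' hm
      exact absurd (hmin L' hLH') (not_le.2 (hle.trans_lt ht.2))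
    · rw [hpe]
      rcases eq_or_ne L' L with rfl | hne
      · exact Or.inr ⟨h1, h3.symm ▸ hs⟩
      · have := hother L' hL' hne
        rw [mem_tube_iff, not_le] at this
        exact Or.inl this
    · have heq' : reflectVel L (σ L * r) s = s.2 := heq
      rw [heq', h2] at h3
      linarith

/-- Collisions do not accumulate. If the times of a sequence of steps converge, then so do the
collision points, to a point `x` of all tubes that are met infinitely often. By convexity the
quantity `⟪q - x, v⟫ - t` does not decrease along the trajectory, and this forces the
trajectory to reach `x` along a straight segment. -/
lemma tendsto_atTop_of_isStep {s : ℕ → E × E} {τ : ℕ → ℝ} (hs : ‖(s 0).2‖ = 1)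
    (hstep : ∀ k, IsStep 𝓛 σ r (s k) (τ k) (s (k + 1)) (τ (k + 1)))
    (hcut : ∀ k, (s (k + 1)).2 = (s k).2 → τ (k + 1) = τ k + 1) : Tendsto τ atTop atTop := by
  have hmono : StrictMono τ := strictMono_nat_of_lt_succ fun k => (hstep k).lt
  rcases tendsto_atTop_of_monotone hmono.monotone with h | ⟨T, hT⟩
  · exact h
  exfalso
  have hnorm : ∀ k, ‖(s k).2‖ = 1 := by
    intro k
    induction k with
    | zero => exact hs
    | succ k ih => rw [(hstep k).norm_eq, ih]
  have hlt : ∀ k, τ k < T := fun k =>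
    (hmono k.lt_succ_self).trans_le (hmono.monotone.ge_of_tendsto hT _)
  set q : ℕ → E := fun k => pos (s k) (τ k) with hq
  have hnext : ∀ k, q (k + 1) = q k + (τ (k + 1) - τ k) • (s k).2 := by
    intro k
    simp only [hq]
    rw [← (hstep k).pos_eq, pos, pos]
    module
  have hdist : ∀ k m, k ≤ m → dist (q k) (q m) ≤ τ m - τ k := by
    intro k m hkm
    induction m, hkm using Nat.le_induction with
    | base => simp
    | succ m _ ih =>
      have : dist (q m) (q (m + 1)) = τ (m + 1) - τ m := by
        rw [hnext, dist_self_add_right, norm_smul, hnorm, mul_one, Real.norm_eq_abs,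
          abs_of_pos (sub_pos.2 (hmono m.lt_succ_self))]
      linarith [dist_triangle (q k) (q m) (q (m + 1))]
  have hgap : Tendsto (fun k => T - τ k) atTop (𝓝 0) := by
    simpa using (tendsto_const_nhds (x := T)).sub hT
  have hcauchy : CauchySeq q := cauchySeq_of_le_tendsto_0' (fun k => T - τ k)
    (fun k m hkm => (hdist k m hkm).trans (by linarith [hlt m])) hgap
  obtain ⟨x, hx⟩ := cauchySeq_tendsto_of_complete hcauchy
  have hdx : ∀ k, ‖q k - x‖ ≤ T - τ k := by
    intro k
    rw [← dist_eq_norm]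
    exact le_of_tendsto_of_tendsto (tendsto_const_nhds.dist hx) (hT.sub_const _)
      (eventually_atTop.2 ⟨k, fun m hm => hdist k m hm⟩)
  have hev : ∀ᶠ k in atTop, ∀ L ∈ 𝓛, q k ∈ tube σ r L → x ∈ tube σ r L := by
    rw [eventually_all_finset]
    intro L _
    by_cases hxL : x ∈ tube σ r L
    · exact Eventually.of_forall fun _ _ => hxL
    · filter_upwards [hx.eventually ((isClosed_tube σ r L).isOpen_compl.mem_nhds hxL)] with k hk hk'
      exact absurd hk' hk
  obtain ⟨K, hK⟩ := eventually_atTop.1 hev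
  set m : ℕ → ℝ := fun k => ⟪q k - x, (s k).2⟫_ℝ - τ k with hm
  have hm_mono : ∀ k, K ≤ k → m k ≤ m (k + 1) := by
    intro k hk
    have h1 : ⟪q (k + 1) - x, (s k).2⟫_ℝ = ⟪q k - x, (s k).2⟫_ℝ + (τ (k + 1) - τ k) := by
      rw [hnext, add_sub_right_comm, inner_add_left, inner_smul_left, real_inner_self_eq_norm_sq,
        hnorm]
      simp
    have hlaw := (hstep k).law
    rw [(hstep k).pos_eq] at hlaw
    have h2 := hlaw.inner_sub_le (hK (k + 1) (by omega))
    simp only [hm]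
    simp only [hq] at h1 h2 ⊢
    linarith
  have hm_lim : Tendsto m atTop (𝓝 (0 - T)) := by
    refine Tendsto.sub (squeeze_zero_norm (fun k => ?_) hgap) hT
    exact (norm_inner_le_norm _ _).trans (by rw [hnorm, mul_one]; exact hdx k)
  have hm_le : ∀ k, K ≤ k → m k ≤ 0 - T := by
    intro k hk
    refine ge_of_tendsto hm_lim (eventually_atTop.2 ⟨k, fun j hj => ?_⟩)
    induction j, hj using Nat.le_induction with
    | base => rfl
    | succ j hj ih => exact ih.trans (hm_mono j (hk.trans hj))
  have hstraight : ∀ k, K ≤ k → x - q k = (T - τ k) • (s k).2 := by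
    intro k hk
    have h1 := hm_le k hk
    simp only [hm] at h1
    have h2 := hdx k
    rw [← sub_eq_zero, ← norm_eq_zero]
    have h3 : ‖x - q k - (T - τ k) • (s k).2‖ ^ 2 ≤ 0 := by
      rw [norm_sub_sq_real, inner_smul_right, norm_smul, hnorm, mul_one, ← neg_sub (q k) x,
        inner_neg_left, norm_neg, Real.norm_eq_abs, sq_abs]
      have := hlt k
      nlinarith [norm_nonneg (q k - x)]
    exact pow_eq_zero_iff two_ne_zero |>.1 (le_antisymm h3 (sq_nonneg _))
  have hconst : ∀ k, K ≤ k → τ (k + 1) = τ k + 1 := by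
    intro k hk
    refine hcut k ?_
    have h1 := hstraight k hk
    have h2 := hstraight (k + 1) (by omega)
    rw [hnext, ← sub_sub, h1, ← sub_smul] at h2
    have h3 : (T - τ (k + 1)) • ((s (k + 1)).2 - (s k).2) = 0 := by
      rw [smul_sub, ← h2]
      module
    exact sub_eq_zero.1 ((smul_eq_zero.1 h3).resolve_left (sub_pos.2 (hlt _)).ne')
  have h1 : Tendsto (fun k => τ (k + 1) - τ k) atTop (𝓝 (T - T)) :=
    ((tendsto_add_atTop_iff_nat 1).2 hT).sub hT
  have h2 : Tendsto (fun k => τ (k + 1) - τ k) atTop (𝓝 1) :=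
    tendsto_const_nhds.congr' (eventually_atTop.2 ⟨K, fun k hk => by simp [hconst k hk]⟩)
  have := tendsto_nhds_unique h1 h2
  simp at this

/-! ### Thickened trajectories from sequences of steps -/

lemma exists_piecewise_pos {s : ℕ → E × E} {τ : ℕ → ℝ} (hmono : StrictMono τ)
    (hτ : Tendsto τ atTop atTop) (hpos : ∀ k, pos (s k) (τ (k + 1)) = pos (s (k + 1)) (τ (k + 1))) :
    ∃ q : ℝ → E, ∀ k, ∀ t ∈ Set.Icc (τ k) (τ (k + 1)), q t = pos (s k) t := by
  classical
  have hex : ∀ t, ∃ k, t < τ (k + 1) := fun t =>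
    (((tendsto_add_atTop_iff_nat 1).2 hτ).eventually_gt_atTop t).exists
  have hfind : ∀ k t, τ k ≤ t → t < τ (k + 1) → Nat.find (hex t) = k := by
    intro k t h1 h2
    rw [Nat.find_eq_iff]
    exact ⟨h2, fun j hj => not_lt.2 ((hmono.monotone hj).trans h1)⟩
  refine ⟨fun t => pos (s (Nat.find (hex t))) t, fun k t ht => ?_⟩
  rcases ht.2.lt_or_eq with h | rfl
  · simp only [hfind k t ht.1 h]
  · simp only [hfind (k + 1) _ le_rfl (hmono (Nat.lt_succ_self (k + 1))), hpos]

lemma hasVelocityAfter_of_eq_pos {q : ℝ → E} {s : E × E} {t u : ℝ} (htu : t < u)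
    (h : ∀ x ∈ Set.Icc t u, q x = pos s x) : HasVelocityAfter q t s.2 := by
  filter_upwards [Icc_mem_nhdsGE htu] with x hx
  rw [h x hx, h t ⟨le_rfl, htu.le⟩, pos, pos]
  module

lemma hasVelocityBefore_of_eq_pos {q : ℝ → E} {s : E × E} {t u : ℝ} (hut : u < t)
    (h : ∀ x ∈ Set.Icc u t, q x = pos s x) : HasVelocityBefore q t s.2 := by
  filter_upwards [Icc_mem_nhdsLE hut] with x hx
  rw [h x hx, h t ⟨hut.le, le_rfl⟩, pos, pos]
  module

lemma exists_lt_le_succ {τ : ℕ → ℝ} (hτ : Tendsto τ atTop atTop) {t : ℝ} (ht : τ 0 < t) :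
    ∃ k, τ k < t ∧ t ≤ τ (k + 1) := by
  classical
  have hex : ∃ k, t ≤ τ k := (hτ.eventually_ge_atTop t).exists
  obtain ⟨k, hk⟩ := Nat.exists_eq_succ_of_ne_zero (n := Nat.find hex) fun h0 => by
    have := Nat.find_spec hex
    rw [h0] at this
    linarith
  refine ⟨k, not_le.1 (Nat.find_min hex (by omega)), ?_⟩
  have := Nat.find_spec hex
  rwa [hk] at this

lemma exists_movesAt_of_isStep {s : ℕ → E × E} {τ : ℕ → ℝ} (hs : ‖(s 0).2‖ = 1)
    (hstep : ∀ k, IsStep 𝓛 σ r (s k) (τ k) (s (k + 1)) (τ (k + 1)))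
    (hτ : Tendsto τ atTop atTop) :
    ∃ q : ℝ → E, (∀ k, ∀ t ∈ Set.Icc (τ k) (τ (k + 1)), q t = pos (s k) t) ∧
      ∀ t, τ 0 < t → ∃ v₁ v₂, MovesAt 𝓛 σ r q t v₁ v₂ := by
  have hmono : StrictMono τ := strictMono_nat_of_lt_succ fun k => (hstep k).lt
  have hnorm : ∀ k, ‖(s k).2‖ = 1 := by
    intro k
    induction k with
    | zero => exact hs
    | succ k ih => rw [(hstep k).norm_eq, ih]
  obtain ⟨q, hq⟩ := exists_piecewise_pos hmono hτ fun k => (hstep k).pos_eq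
  refine ⟨q, hq, fun t ht => ?_⟩
  obtain ⟨k, hk1, hk2⟩ := exists_lt_le_succ hτ ht
  have hqt := hq k t ⟨hk1.le, hk2⟩
  have hb : HasVelocityBefore q t (s k).2 :=
    hasVelocityBefore_of_eq_pos hk1 fun x hx => hq k x ⟨hx.1, hx.2.trans hk2⟩
  rcases hk2.lt_or_eq with hlt | rfl
  · refine ⟨(s k).2, (s k).2, hb, ?_, hnorm k, hnorm k, ?_⟩
    · exact hasVelocityAfter_of_eq_pos hlt fun x hx => hq k x ⟨hk1.le.trans hx.1, hx.2⟩
    · rw [hqt]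
      exact collisionLaw_self ((hstep k).free t ⟨hk1, hlt⟩) _
  · refine ⟨(s k).2, (s (k + 1)).2, hb, ?_, hnorm k, hnorm _, ?_⟩
    · exact hasVelocityAfter_of_eq_pos (hmono (Nat.lt_succ_self (k + 1))) (hq (k + 1))
    · rw [hqt]
      exact (hstep k).law

lemma exists_isStep_sequence (hσ : ∀ L ∈ 𝓛, 0 < σ L * r) {s : E × E} {τ : ℝ}
    (hs : ‖s.2‖ = 1) (hg : IsGeneric 𝓛 σ r s) (ho : IsOutgoing 𝓛 σ r s τ) :
    ∃ (S : ℕ → E × E) (θ : ℕ → ℝ), S 0 = s ∧ θ 0 = τ ∧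
      (∀ k, IsStep 𝓛 σ r (S k) (θ k) (S (k + 1)) (θ (k + 1))) ∧ Tendsto θ atTop atTop := by
  let X := {p : (E × E) × ℝ // IsGeneric 𝓛 σ r p.1 ∧ IsOutgoing 𝓛 σ r p.1 p.2}
  have hX : ∀ p : X, ∃ p' : X, IsStep 𝓛 σ r p.1.1 p.1.2 p'.1.1 p'.1.2 ∧
      (p'.1.1.2 = p.1.1.2 → p'.1.2 = p.1.2 + 1) := by
    intro p
    obtain ⟨s', τ', h1, h2, h3, h4⟩ := exists_isStep hσ p.2.1 p.2.2
    exact ⟨⟨(s', τ'), h2, h3⟩, h1, h4⟩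
  choose f hf using hX
  let p : ℕ → X := fun k => f^[k] ⟨(s, τ), hg, ho⟩
  have hp : ∀ k, p (k + 1) = f (p k) := fun k => Function.iterate_succ_apply' f k _
  have hstep : ∀ k, IsStep 𝓛 σ r (p k).1.1 (p k).1.2 (p (k + 1)).1.1 (p (k + 1)).1.2 := by
    intro k
    rw [hp]
    exact (hf (p k)).1
  refine ⟨fun k => (p k).1.1, fun k => (p k).1.2, rfl, rfl, hstep,
    tendsto_atTop_of_isStep hs hstep fun k => ?_⟩
  rw [hp]
  exact (hf (p k)).2

/-- A finite sequence of steps that ends with a generic outgoing motion extends to a trajectory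
for all future times. -/
lemma exists_movesAt_extending (hσ : ∀ L ∈ 𝓛, 0 < σ L * r) {m : ℕ} {s : ℕ → E × E}
    {τ : ℕ → ℝ} (hs : ‖(s 0).2‖ = 1)
    (hstep : ∀ k < m, IsStep 𝓛 σ r (s k) (τ k) (s (k + 1)) (τ (k + 1)))
    (hg : IsGeneric 𝓛 σ r (s m)) (ho : IsOutgoing 𝓛 σ r (s m) (τ m)) :
    ∃ q : ℝ → E, q (τ 0) = pos (s 0) (τ 0) ∧ HasVelocityAfter q (τ 0) (s 0).2 ∧
      (∀ k < m, ∀ t ∈ Set.Icc (τ k) (τ (k + 1)), q t = pos (s k) t) ∧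
      ∀ t, τ 0 < t → ∃ v₁ v₂, MovesAt 𝓛 σ r q t v₁ v₂ := by
  have hnorm : ∀ k ≤ m, ‖(s k).2‖ = 1 := by
    intro k hk
    induction k with
    | zero => exact hs
    | succ k ih => rw [(hstep k hk).norm_eq, ih (by omega)]
  obtain ⟨S, θ, hS0, hθ0, hS, hθ⟩ := exists_isStep_sequence hσ (hnorm m le_rfl) hg ho
  let s' : ℕ → E × E := fun k => if k < m then s k else S (k - m)
  let τ' : ℕ → ℝ := fun k => if k < m then τ k else θ (k - m)
  have hs' : ∀ k ≤ m, s' k = s k := by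
    intro k hk
    rcases hk.lt_or_eq with h | rfl
    · simp [s', h]
    · simp [s', hS0]
  have hτ' : ∀ k ≤ m, τ' k = τ k := by
    intro k hk
    rcases hk.lt_or_eq with h | rfl
    · simp [τ', h]
    · simp [τ', hθ0]
  have hstep' : ∀ k, IsStep 𝓛 σ r (s' k) (τ' k) (s' (k + 1)) (τ' (k + 1)) := by
    intro k
    rcases lt_or_ge k m with h | h
    · rw [hs' k h.le, hs' (k + 1) h, hτ' k h.le, hτ' (k + 1) h]
      exact hstep k h
    · have e : k + 1 - m = k - m + 1 := by omega
      simp only [s', τ', not_lt.2 h, not_lt.2 (h.trans k.le_succ), if_false, e]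
      exact hS _
  have hlim : Tendsto τ' atTop atTop := by
    refine (hθ.comp (tendsto_sub_atTop_nat m)).congr' (eventually_atTop.2 ⟨m, fun k hk => ?_⟩)
    simp [τ', not_lt.2 hk]
  obtain ⟨q, hq1, hq2⟩ := exists_movesAt_of_isStep (by rw [hs' 0 m.zero_le, hs]) hstep' hlim
  rw [hτ' 0 m.zero_le] at hq2
  have h0 := hq1 0
  have hlt := (hstep' 0).lt
  rw [hs' 0 m.zero_le] at h0
  refine ⟨q, ?_, ?_, fun k hk t ht => ?_, hq2⟩
  · rw [← hτ' 0 m.zero_le]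
    exact h0 _ ⟨le_rfl, hlt.le⟩
  · rw [← hτ' 0 m.zero_le]
    exact hasVelocityAfter_of_eq_pos hlt h0
  · rw [← hs' k hk.le]
    refine hq1 k t ?_
    rwa [hτ' k hk.le, hτ' (k + 1) hk]

lemma MovesAt.congr {q q' : ℝ → E} {t : ℝ} {v₁ v₂ : E} (h : MovesAt 𝓛 σ r q t v₁ v₂)
    (he : q =ᶠ[𝓝 t] q') : MovesAt 𝓛 σ r q' t v₁ v₂ := by
  have h0 := he.self_of_nhds
  refine ⟨?_, ?_, h.2.2.1, h.2.2.2.1, h0 ▸ h.2.2.2.2⟩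
  · filter_upwards [h.1, nhdsWithin_le_nhds he] with x hx hx'
    rw [← hx', hx, h0]
  · filter_upwards [h.2.1, nhdsWithin_le_nhds he] with x hx hx'
    rw [← hx', hx, h0]

lemma HasVelocityAfter.neg {q : ℝ → E} {t : ℝ} {v : E} (h : HasVelocityAfter q (-t) v) :
    HasVelocityBefore (fun x => q (-x)) t (-v) := by
  have hn : Tendsto (fun x : ℝ => -x) (𝓝[≤] t) (𝓝[≥] (-t)) :=
    tendsto_nhdsWithin_of_tendsto_nhds_of_eventually_within _
      (continuous_neg.tendsto' _ _ rfl |>.mono_left nhdsWithin_le_nhds)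
      (eventually_mem_nhdsWithin.mono fun x hx => neg_le_neg (Set.mem_Iic.1 hx))
  filter_upwards [hn.eventually h] with x hx
  rw [hx]
  module

lemma HasVelocityBefore.neg {q : ℝ → E} {t : ℝ} {v : E} (h : HasVelocityBefore q (-t) v) :
    HasVelocityAfter (fun x => q (-x)) t (-v) := by
  have hn : Tendsto (fun x : ℝ => -x) (𝓝[≥] t) (𝓝[≤] (-t)) :=
    tendsto_nhdsWithin_of_tendsto_nhds_of_eventually_within _
      (continuous_neg.tendsto' _ _ rfl |>.mono_left nhdsWithin_le_nhds)
      (eventually_mem_nhdsWithin.mono fun x hx => neg_le_neg (Set.mem_Ici.1 hx))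
  filter_upwards [hn.eventually h] with x hx
  rw [hx]
  module

/-- Thickened trajectories are reversible. -/
lemma MovesAt.neg {q : ℝ → E} {t : ℝ} {v₁ v₂ : E} (h : MovesAt 𝓛 σ r q (-t) v₁ v₂) :
    MovesAt 𝓛 σ r (fun x => q (-x)) t (-v₂) (-v₁) :=
  ⟨h.2.1.neg, h.1.neg, by rw [norm_neg, h.2.2.2.1], by rw [norm_neg, h.2.2.1], h.2.2.2.2.rev⟩

lemma continuousAt_of_hasVelocity {q : ℝ → E} {t : ℝ} {v₁ v₂ : E} (h1 : HasVelocityBefore q t v₁)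
    (h2 : HasVelocityAfter q t v₂) : ContinuousAt q t := by
  rw [continuousAt_iff_continuous_left_right]
  have key : ∀ v : E, ContinuousAt (fun s : ℝ => q t + (s - t) • v) t := fun v => by fun_prop
  constructor
  · exact (key v₁).continuousWithinAt.congr_of_eventuallyEq h1 (by simp)
  · exact (key v₂).continuousWithinAt.congr_of_eventuallyEq h2 (by simp)

lemma MovesAt.mem_table {q : ℝ → E} {t : ℝ} {v₁ v₂ : E} (h : MovesAt 𝓛 σ r q t v₁ v₂) :
    q t ∈ table 𝓛 σ r := by
  obtain ⟨hb, ha, -, -, hl⟩ := h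
  have hcont := continuousAt_of_hasVelocity hb ha
  refine mem_closure_of_tendsto (hcont.mono_left (nhdsWithin_le_nhds (s := Set.Ioi t))) ?_
  have hfar : ∀ᶠ x in 𝓝[>] t, ∀ L ∈ 𝓛, q t ∉ tube σ r L → q x ∉ tube σ r L := by
    rw [eventually_all_finset]
    intro L _
    by_cases hm : q t ∈ tube σ r L
    · exact Eventually.of_forall fun _ h => absurd hm h
    · filter_upwards [nhdsWithin_le_nhds (hcont.eventually
        ((isClosed_tube σ r L).isOpen_compl.mem_nhds hm))] with x hx _ using hx
  have ha' : ∀ᶠ x in 𝓝[>] t, q x = q t + (x - t) • v₂ :=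
    ha.filter_mono (nhdsWithin_mono _ Set.Ioi_subset_Ici_self)
  filter_upwards [hfar, ha', self_mem_nhdsWithin] with x hx hx' hxt
  simp only [Set.mem_compl_iff, Set.mem_iUnion, not_exists]
  intro L hL
  by_cases hm : q t ∈ tube σ r L
  · obtain ⟨h1, -, h3, h4⟩ := hl.rev.2 L hL hm
    rw [mem_tubeWall_iff] at h1
    rw [unitNormal_eq, inner_neg_left, inner_smul_right, inner_perp_right, neg_lt_zero] at h3
    have h5 : 0 < ⟪perp L (q t), perp L v₂⟫_ℝ := by
      rw [real_inner_comm]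
      exact pos_of_mul_pos_right h3 (by positivity)
    have h6 := lt_norm_perp_of_exit (L := L) (s := (q t, v₂)) (t₀ := 0) (t := x - t)
      (sub_pos.2 hxt) (by simpa [pos] using h5)
    rw [mem_tube_iff, not_le, hx', ← h1]
    simpa [pos] using h6
  · exact hx L hL hm

/-- A finite sequence of steps that starts outside of the tubes and whose first and last motions
are generic extends to a thickened trajectory for all times. -/
lemma exists_isThickenedTrajectory (hσ : ∀ L ∈ 𝓛, 0 < σ L * r) {m : ℕ} {s : ℕ → E × E}
    {τ : ℕ → ℝ} (hs : ‖(s 0).2‖ = 1)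
    (hstep : ∀ k < m, IsStep 𝓛 σ r (s k) (τ k) (s (k + 1)) (τ (k + 1)))
    (hg : IsGeneric 𝓛 σ r (s m)) (ho : IsOutgoing 𝓛 σ r (s m) (τ m))
    (hg0 : IsGeneric 𝓛 σ r (rev (s 0))) (h0 : ∀ L ∈ 𝓛, pos (s 0) (τ 0) ∉ tube σ r L) :
    ∃ q : C(ℝ, E), IsThickenedTrajectory 𝓛 σ r q ∧
      ∀ k < m, ∀ t ∈ Set.Icc (τ k) (τ (k + 1)), q t = pos (s k) t := by
  obtain ⟨f, hf0, hfv, hf, hfm⟩ := exists_movesAt_extending hσ hs hstep hg ho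
  have hp0 : pos (rev (s 0)) (-τ 0) = pos (s 0) (τ 0) := by rw [pos_rev, neg_neg]
  -- the past of the trajectory is the reversed future of the reversed motion
  obtain ⟨b, hb0, hbv, -, hbm⟩ := exists_movesAt_extending hσ (m := 0)
    (s := fun _ => rev (s 0)) (τ := fun _ => -τ 0) (by simp [rev, hs]) (by simp) hg0
    (fun L hL => Or.inl (by
      have := h0 L hL
      rwa [mem_tube_iff, not_le, ← hp0] at this))
  let q : ℝ → E := fun t => if τ 0 ≤ t then f t else b (-t)
  have hq0 : q (τ 0) = pos (s 0) (τ 0) := by simp [q, hf0]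
  have hmoves : ∀ t, ∃ v₁ v₂, MovesAt 𝓛 σ r q t v₁ v₂ := by
    intro t
    rcases lt_trichotomy t (τ 0) with ht | rfl | ht
    · obtain ⟨v₁, v₂, h⟩ := hbm (-t) (neg_lt_neg ht)
      refine ⟨_, _, h.neg.congr ?_⟩
      filter_upwards [Iio_mem_nhds ht] with x hx
      simp [q, not_le.2 (Set.mem_Iio.1 hx)]
    · refine ⟨(s 0).2, (s 0).2, ?_, ?_, hs, hs, ?_⟩
      · have hbv' := hbv.neg
        simp only [rev, neg_neg] at hbv'
        filter_upwards [hbv', self_mem_nhdsWithin] with x hx hx'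
        rcases (show x ≤ τ 0 from hx').lt_or_eq with h | rfl
        · simp only [q, not_le.2 h, if_false, le_refl, if_true]
          rw [hx, hb0, hp0, hf0]
        · simp
      · filter_upwards [hfv, self_mem_nhdsWithin] with x hx hx'
        simp only [q, le_refl, if_true, if_pos (show τ 0 ≤ x from hx'), hx]
      · rw [hq0]
        exact collisionLaw_self h0 _
    · obtain ⟨v₁, v₂, h⟩ := hfm t ht
      refine ⟨v₁, v₂, h.congr ?_⟩
      filter_upwards [Ioi_mem_nhds ht] with x hx
      simp [q, (Set.mem_Ioi.1 hx).le]
  have hcont : Continuous q := continuous_iff_continuousAt.2 fun t => by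
    obtain ⟨v₁, v₂, h⟩ := hmoves t
    exact continuousAt_of_hasVelocity h.1 h.2.1
  refine ⟨⟨q, hcont⟩, ⟨fun t => ?_, hmoves⟩, fun k hk t ht => ?_⟩
  · obtain ⟨v₁, v₂, h⟩ := hmoves t
    exact h.mem_table
  · have hle : ∀ j ≤ m, τ 0 ≤ τ j := by
      intro j hj
      induction j with
      | zero => rfl
      | succ j ih => exact (ih (by omega)).trans (hstep j hj).lt.le
    have : τ 0 ≤ t := (hle k hk.le).trans ht.1
    simp only [ContinuousMap.coe_mk, q, if_pos this]
    exact hf k hk t ht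

/-! ### The itinerary of a point billiard trajectory -/

/-- Between the times `a` and `b` the curve `q` is the polygon with the vertices `q (t i)`,
`i ≤ n + 1`, and the velocities `v i`, `i ≤ n`. The inner vertices `1 ≤ i ≤ n` are its collisions
in this interval; each of them is proper and involves the single subspace `L i`. -/
structure IsItinerary (𝓛 : Finset (Submodule ℝ E)) (q : ℝ → E) (a b : ℝ) (n : ℕ) (t : ℕ → ℝ)
    (v : ℕ → E) (L : ℕ → Submodule ℝ E) : Prop where
  t_zero : t 0 = a
  t_last : t (n + 1) = b
  lt_succ : ∀ i ≤ n, t i < t (i + 1)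
  eq_line : ∀ i ≤ n, ∀ u ∈ Set.Icc (t i) (t (i + 1)), q u = q (t i) + (u - t i) • v i
  norm_vel : ∀ i ≤ n, ‖v i‖ = 1
  free : ∀ i ≤ n, ∀ u ∈ Set.Ioo (t i) (t (i + 1)), ∀ L' ∈ 𝓛, q u ∉ L'
  free_start : ∀ L' ∈ 𝓛, q a ∉ L'
  free_end : ∀ L' ∈ 𝓛, q b ∉ L'
  mem : ∀ i < n, L (i + 1) ∈ 𝓛
  vertex_mem : ∀ i < n, q (t (i + 1)) ∈ L (i + 1)
  eq_of_vertex_mem : ∀ i < n, ∀ L' ∈ 𝓛, q (t (i + 1)) ∈ L' → L' = L (i + 1)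
  vel_ne : ∀ i < n, v (i + 1) ≠ v i
  proj_vel : ∀ i < n, (L (i + 1)).starProjection (v (i + 1)) = (L (i + 1)).starProjection (v i)

lemma HasVelocityBefore.unique {q : ℝ → E} {t : ℝ} {v w : E} (hv : HasVelocityBefore q t v)
    (hw : HasVelocityBefore q t w) : v = w := by
  have h : ∀ᶠ s in 𝓝[<] t, s < t ∧ q s = q t + (s - t) • v ∧ q s = q t + (s - t) • w :=
    (eventually_mem_nhdsWithin (s := Set.Iio t)).and
      ((hv.filter_mono (nhdsWithin_mono _ Set.Iio_subset_Iic_self)).and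
        (hw.filter_mono (nhdsWithin_mono _ Set.Iio_subset_Iic_self)))
  obtain ⟨s, hst, h1, h2⟩ := h.exists
  rw [h1, add_right_inj] at h2
  exact smul_right_injective E (sub_neg.2 hst).ne h2

/-- A curve whose velocity does not jump in the interior of an interval is straight there. -/
lemma eq_line_of_hasVelocity {q : ℝ → E} (hq : Continuous q) {c d : ℝ} {v : E}
    (hv : HasVelocityAfter q c v)
    (h : ∀ u ∈ Set.Ioo c d, ∃ w, HasVelocityBefore q u w ∧ HasVelocityAfter q u w) :
    ∀ u ∈ Set.Icc c d, q u = q c + (u - c) • v := by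
  set S : Set ℝ := {u | ∀ y ∈ Set.Icc c u, q y = q c + (y - c) • v} with hS
  have hline : IsClosed {y | q y = q c + (y - c) • v} := isClosed_eq hq (by fun_prop)
  have hclosed : IsClosed S := by
    refine isClosed_of_closure_subset fun u hu y hy => ?_
    have hlt : ∀ y ∈ Set.Ico c u, q y = q c + (y - c) • v := by
      intro y hy
      obtain ⟨u', hu', hu'S⟩ := mem_closure_iff.1 hu (Set.Ioi y) isOpen_Ioi hy.2
      exact hu'S y ⟨hy.1, (Set.mem_Ioi.1 hu').le⟩
    rcases hy.2.lt_or_eq with hyu | rfl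
    · exact hlt y ⟨hy.1, hyu⟩
    rcases hy.1.lt_or_eq with hcy | rfl
    · have : y ∈ closure (Set.Ico c y) := by
        rw [closure_Ico hcy.ne]
        exact ⟨hcy.le, le_rfl⟩
      exact hline.closure_subset_iff.2 hlt this
    · simp
  have hsub : Set.Icc c d ⊆ S := by
    refine (hclosed.inter isClosed_Icc).Icc_subset_of_forall_exists_gt ?_ ?_
    · intro y hy
      obtain rfl : y = c := le_antisymm hy.2 hy.1
      simp
    rintro x ⟨hxS, hcx, hxd⟩ y hxy
    have hx := hxS x ⟨hcx, le_rfl⟩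
    have hafter : HasVelocityAfter q x v := by
      rcases hcx.lt_or_eq with hlt | rfl
      · obtain ⟨w, hw1, hw2⟩ := h x ⟨hlt, hxd⟩
        have hb : HasVelocityBefore q x v := by
          filter_upwards [Icc_mem_nhdsLE hlt] with z hz
          rw [hx, hxS z hz]
          module
        rwa [hb.unique hw1]
      · exact hv
    obtain ⟨z, hxz, hz⟩ := mem_nhdsGE_iff_exists_Icc_subset.1 hafter
    refine ⟨min z y, fun w hw => ?_, lt_min hxz hxy, min_le_right _ _⟩
    rcases le_total w x with hwx | hxw
    · exact hxS w ⟨hw.1, hwx⟩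
    · have h1 : q w = q x + (w - x) • v := hz ⟨hxw, hw.2.trans (min_le_left _ _)⟩
      rw [h1, hx]
      module
  exact fun u hu => hsub hu u ⟨hu.1, le_rfl⟩

lemma finite_collisions {q : ℝ → E} (h : ∀ t, ∀ᶠ s in 𝓝[≠] t, q s ∉ collisionLocus 𝓛) (a b : ℝ) :
    (Set.Icc a b ∩ {u | q u ∈ collisionLocus 𝓛}).Finite := by
  by_contra hinf
  obtain ⟨x, -, hx⟩ := Set.Infinite.exists_accPt_of_subset_isCompact hinf isCompact_Icc
    Set.inter_subset_left
  rw [accPt_iff_frequently] at hx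
  have := h x
  rw [eventually_nhdsWithin_iff] at this
  obtain ⟨y, ⟨hy1, hy2⟩, hy3⟩ := (hx.and_eventually this).exists
  exact hy3 hy1 hy2.2

/-- The elements of a finite set of reals containing `a` and `b` as its extreme members,
enumerated in increasing order. -/
lemma exists_enumeration {a b : ℝ} (hab : a < b) {F : Set ℝ} (hF : F.Finite)
    (hFab : F ⊆ Set.Ioo a b) :
    ∃ (n : ℕ) (t : ℕ → ℝ), t 0 = a ∧ t (n + 1) = b ∧ (∀ i ≤ n, t i < t (i + 1)) ∧
      (∀ i < n, t (i + 1) ∈ F) ∧ ∀ i ≤ n, ∀ u ∈ Set.Ioo (t i) (t (i + 1)), u ∉ F := by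
  classical
  set G : Finset ℝ := insert a (insert b hF.toFinset) with hG
  have hmemG : ∀ u, u ∈ G ↔ u = a ∨ u = b ∨ u ∈ F := by simp [hG]
  have hGab : ∀ u ∈ G, a ≤ u ∧ u ≤ b := by
    intro u hu
    rcases (hmemG u).1 hu with rfl | rfl | h
    · exact ⟨le_rfl, hab.le⟩
    · exact ⟨hab.le, le_rfl⟩
    · exact ⟨(hFab h).1.le, (hFab h).2.le⟩
  have haG : a ∈ G := (hmemG a).2 (Or.inl rfl)
  have hbG : b ∈ G := (hmemG b).2 (Or.inr (Or.inl rfl))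
  obtain ⟨n, hn⟩ : ∃ n, G.card = n + 2 := by
    have : 1 < G.card := Finset.one_lt_card.2 ⟨a, haG, b, hbG, hab.ne⟩
    exact ⟨G.card - 2, by omega⟩
  set e := G.orderEmbOfFin hn with he
  have heG : ∀ i, e i ∈ G := G.orderEmbOfFin_mem hn
  have hsurj : ∀ u ∈ G, ∃ i, e i = u := by
    intro u hu
    have : u ∈ Set.range e := by rw [he, Finset.range_orderEmbOfFin]; exact hu
    exact this
  let t : ℕ → ℝ := fun i => if h : i < n + 2 then e ⟨i, h⟩ else b
  have ht : ∀ i (h : i < n + 2), t i = e ⟨i, h⟩ := fun i h => by simp [t, h]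
  have h0 : t 0 = a := by
    obtain ⟨i, hi⟩ := hsurj a haG
    refine le_antisymm ?_ (by rw [ht 0 (by omega)]; exact (hGab _ (heG _)).1)
    rw [ht 0 (by omega), ← hi]
    exact e.monotone (Fin.mk_le_of_le_val (Nat.zero_le _))
  have hlast : t (n + 1) = b := by
    obtain ⟨i, hi⟩ := hsurj b hbG
    refine le_antisymm (by rw [ht (n + 1) (by omega)]; exact (hGab _ (heG _)).2) ?_
    rw [ht (n + 1) (by omega), ← hi]
    exact e.monotone (Fin.le_def.2 (by have := i.2; simp only; omega))
  have hlt : ∀ i ≤ n, t i < t (i + 1) := by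
    intro i hi
    rw [ht i (by omega), ht (i + 1) (by omega)]
    exact e.strictMono (Fin.lt_def.2 (by simp))
  refine ⟨n, t, h0, hlast, hlt, fun i hi => ?_, fun i hi u hu huF => ?_⟩
  · have hmem : t (i + 1) ∈ G := by rw [ht _ (by omega)]; exact heG _
    rcases (hmemG _).1 hmem with h | h | h
    · exfalso
      have : t 0 < t (i + 1) := by
        rw [ht 0 (by omega), ht (i + 1) (by omega)]
        exact e.strictMono (Fin.lt_def.2 (by simp))
      rw [h0, h] at this
      exact lt_irrefl _ this
    · exfalso
      have : t (i + 1) < t (n + 1) := by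
        rw [ht (n + 1) (by omega), ht (i + 1) (by omega)]
        exact e.strictMono (Fin.lt_def.2 (by simpa using hi))
      rw [hlast, h] at this
      exact lt_irrefl _ this
    · exact h
  · obtain ⟨j, rfl⟩ := hsurj u ((hmemG u).2 (Or.inr (Or.inr huF)))
    rw [ht i (by omega), ht (i + 1) (by omega)] at hu
    have h1 := e.lt_iff_lt.1 hu.1
    have h2 := e.lt_iff_lt.1 hu.2
    rw [Fin.lt_def] at h1 h2
    simp only at h1 h2
    omega

lemma mem_collisionLocus {x : E} : x ∈ collisionLocus 𝓛 ↔ ∃ L ∈ 𝓛, x ∈ L := by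
  simp [collisionLocus]

lemma exists_isItinerary {q : C(ℝ, E)} (hq : IsPointBilliardTrajectory 𝓛 q)
    (hmult : HasNoMultipleCollisions 𝓛 q) (htrans : IsTransverse 𝓛 q) {a b : ℝ} (hab : a < b)
    (ha : q a ∉ collisionLocus 𝓛) (hb : q b ∉ collisionLocus 𝓛) :
    ∃ n t v L, IsItinerary 𝓛 q a b n t v L := by
  have hF : (Set.Ioo a b ∩ {u | q u ∈ collisionLocus 𝓛}).Finite :=
    (finite_collisions hq.discrete_collisions a b).subset
      (Set.inter_subset_inter_left _ Set.Ioo_subset_Icc_self)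
  obtain ⟨n, t, h0, hlast, hlt, hcol, hfree⟩ :=
    exists_enumeration hab hF Set.inter_subset_left
  have hmono : ∀ i ≤ n + 1, a ≤ t i := by
    intro i hi
    induction i with
    | zero => exact h0.ge
    | succ i ih => exact (ih (by omega)).trans (hlt i (by omega)).le
  have hmono' : ∀ k ≤ n + 1, t (n + 1 - k) ≤ b := by
    intro k hk
    induction k with
    | zero => exact hlast.le
    | succ k ih =>
      refine le_trans ?_ (ih (by omega))
      have := hlt (n + 1 - (k + 1)) (by omega)
      rw [show n + 1 - (k + 1) + 1 = n + 1 - k by omega] at this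
      exact this.le
  have hle : ∀ i ≤ n + 1, t i ≤ b := by
    intro i hi
    have := hmono' (n + 1 - i) (by omega)
    rwa [show n + 1 - (n + 1 - i) = i by omega] at this
  have hfree' : ∀ i ≤ n, ∀ u ∈ Set.Ioo (t i) (t (i + 1)), q u ∉ collisionLocus 𝓛 := by
    intro i hi u hu hc
    exact hfree i hi u hu
      ⟨⟨(hmono i (by omega)).trans_lt hu.1, hu.2.trans_le (hle _ (by omega))⟩, hc⟩
  choose vb va hvb hva hnb hna hnocol hcoll using hq.velocity
  have hline : ∀ i ≤ n, ∀ u ∈ Set.Icc (t i) (t (i + 1)), q u = q (t i) + (u - t i) • va (t i) := by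
    intro i hi
    refine eq_line_of_hasVelocity q.continuous (hva _) fun u hu => ⟨vb u, hvb u, ?_⟩
    rw [← hnocol u (hfree' i hi u hu)]
    exact hva u
  have hbefore : ∀ i ≤ n, vb (t (i + 1)) = va (t i) := by
    intro i hi
    refine (hvb _).unique ?_
    filter_upwards [Icc_mem_nhdsLE (hlt i hi)] with x hx
    rw [hline i hi x hx, hline i hi _ ⟨(hlt i hi).le, le_rfl⟩]
    module
  have hL : ∀ i, ∃ L, i < n → L ∈ 𝓛 ∧ q (t (i + 1)) ∈ L ∧
      L.starProjection (va (t (i + 1))) = L.starProjection (vb (t (i + 1))) := by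
    intro i
    by_cases hi : i < n
    · obtain ⟨L, h1, h2, h3⟩ := hcoll (t (i + 1)) (hcol i hi).2
      exact ⟨L, fun _ => ⟨h1, h2, h3⟩⟩
    · exact ⟨⊥, fun h => absurd h hi⟩
  choose L hL using hL
  refine ⟨n, t, fun i => va (t i), fun i => L (i - 1), h0, hlast, hlt, hline, fun i _ => hna _,
    fun i hi u hu L' hL' hm => hfree' i hi u hu (mem_collisionLocus.2 ⟨L', hL', hm⟩),
    fun L' hL' hm => ha (mem_collisionLocus.2 ⟨L', hL', hm⟩),
    fun L' hL' hm => hb (mem_collisionLocus.2 ⟨L', hL', hm⟩),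
    fun i hi => (hL i hi).1, fun i hi => (hL i hi).2.1,
    fun i hi L' hL' hm => hmult _ _ hL' _ (hL i hi).1 hm (hL i hi).2.1, fun i hi heq => ?_,
    fun i hi => ?_⟩
  · refine htrans (t (i + 1)) ⟨(hcol i hi).2, va (t (i + 1)), ?_, hva _⟩
    have := hvb (t (i + 1))
    rwa [hbefore i hi.le, ← heq] at this
  · have := (hL i hi).2.2
    rwa [hbefore i hi.le] at this

/-! ### Shortest polygons with vertices on tubes -/

/-- The length of the polygon with the vertices `p 0, …, p (n + 1)`. -/
def polyLength (n : ℕ) (p : ℕ → E) : ℝ := ∑ i ∈ Finset.range (n + 1), ‖p (i + 1) - p i‖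

lemma norm_sub_le_polyLength {n : ℕ} (p : ℕ → E) {i : ℕ} (hi : i ≤ n + 1) :
    ‖p i - p 0‖ ≤ polyLength n p := by
  have h1 : dist (p 0) (p i) ≤ ∑ j ∈ Finset.range i, dist (p j) (p (j + 1)) :=
    dist_le_range_sum_dist p i
  rw [← dist_eq_norm, dist_comm]
  refine h1.trans ?_
  simp only [polyLength, ← dist_eq_norm, dist_comm (p (_ + 1))]
  exact Finset.sum_le_sum_of_subset_of_nonneg (Finset.range_mono hi) fun _ _ _ => dist_nonneg

lemma exists_minimal_polyLength {n : ℕ} {K : ℕ → Set E} {x : ℕ → E} (hK : ∀ i, IsClosed (K i))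
    (hx : ∀ i, x i ∈ K i) (h0 : K 0 ⊆ {x 0}) (hlast : ∀ i, n < i → K i ⊆ {x i}) :
    ∃ p : ℕ → E, (∀ i, p i ∈ K i) ∧
      ∀ p' : ℕ → E, (∀ i, p' i ∈ K i) → polyLength n p ≤ polyLength n p' := by
  let C : ℕ → Set E := fun i =>
    K i ∩ Metric.closedBall (x 0) (max (polyLength n x) ‖x i - x 0‖)
  have hC : IsCompact (Set.pi Set.univ C) := isCompact_univ_pi fun i =>
    (isCompact_closedBall _ _).inter_left (hK i)
  have hxC : x ∈ Set.pi Set.univ C := fun i _ =>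
    ⟨hx i, by rw [Metric.mem_closedBall, dist_eq_norm]; exact le_max_right _ _⟩
  have hcont : Continuous (polyLength n : (ℕ → E) → ℝ) := by
    unfold polyLength
    fun_prop
  obtain ⟨p, hpC, hp⟩ := hC.exists_isMinOn ⟨x, hxC⟩ hcont.continuousOn
  refine ⟨p, fun i => (hpC i trivial).1, fun p' hp' => ?_⟩
  rcases le_total (polyLength n x) (polyLength n p') with h | h
  · exact (hp hxC).trans h
  refine hp fun i _ => ⟨hp' i, ?_⟩
  rw [Metric.mem_closedBall, dist_eq_norm]
  rcases le_or_gt i n with hi | hi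
  · refine le_max_of_le_left (le_trans ?_ h)
    rw [← h0 (hp' 0)]
    exact norm_sub_le_polyLength p' (by omega)
  · refine le_max_of_le_right ?_
    rw [hlast i hi (hp' i)]

/-- Each inner vertex of a shortest polygon minimizes the length of the two adjacent edges. -/
lemma two_edges_le_of_minimal {n : ℕ} {K : ℕ → Set E} {p : ℕ → E} (hpK : ∀ i, p i ∈ K i)
    (hp : ∀ p' : ℕ → E, (∀ i, p' i ∈ K i) → polyLength n p ≤ polyLength n p') {i : ℕ} (hi : i < n)
    {z : E} (hz : z ∈ K (i + 1)) :
    ‖p (i + 1) - p i‖ + ‖p (i + 2) - p (i + 1)‖ ≤ ‖z - p i‖ + ‖p (i + 2) - z‖ := by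
  set p' := Function.update p (i + 1) z with hp'
  have h1 : polyLength n p ≤ polyLength n p' := by
    refine hp p' fun j => ?_
    rcases eq_or_ne j (i + 1) with rfl | hj
    · simpa [hp'] using hz
    · simpa [hp', hj] using hpK j
  have h2 : polyLength n p' - polyLength n p =
      ∑ j ∈ {i, i + 1}, (‖p' (j + 1) - p' j‖ - ‖p (j + 1) - p j‖) := by
    rw [polyLength, polyLength, ← Finset.sum_sub_distrib]
    symm
    refine Finset.sum_subset (fun j hj => ?_) fun j _ hj => ?_
    · simp only [Finset.mem_insert, Finset.mem_singleton] at hj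
      exact Finset.mem_range.2 (by omega)
    · simp only [Finset.mem_insert, Finset.mem_singleton, not_or] at hj
      have e1 : p' j = p j := Function.update_of_ne hj.2 _ _
      have e2 : p' (j + 1) = p (j + 1) := Function.update_of_ne (by omega) _ _
      rw [e1, e2, sub_self]
  rw [Finset.sum_pair (by omega)] at h2
  have e1 : p' i = p i := Function.update_of_ne (by omega) _ _
  have e2 : p' (i + 1) = z := Function.update_self _ _ _
  have e3 : p' (i + 1 + 1) = p (i + 1 + 1) := Function.update_of_ne (by omega) _ _
  rw [e1, e2, e3] at h2
  linarith

/-- A quadratic upper bound for the norm along a line, exact to first order. -/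
lemma norm_add_smul_le {d h : E} (hd : d ≠ 0) (s : ℝ) :
    ‖d + s • h‖ ≤ ‖d‖ + s * ⟪‖d‖⁻¹ • d, h⟫_ℝ + s ^ 2 * (‖h‖ ^ 2 / (2 * ‖d‖)) := by
  have hd' : 0 < ‖d‖ := norm_pos_iff.2 hd
  have h1 : ‖d + s • h‖ ^ 2 = ‖d‖ ^ 2 + 2 * s * ⟪d, h⟫_ℝ + s ^ 2 * ‖h‖ ^ 2 := by
    rw [norm_add_sq_real, inner_smul_right, norm_smul, mul_pow, Real.norm_eq_abs, sq_abs]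
    ring
  have h2 : ‖d‖ + s * ⟪‖d‖⁻¹ • d, h⟫_ℝ + s ^ 2 * (‖h‖ ^ 2 / (2 * ‖d‖))
      = (‖d‖ ^ 2 + ‖d + s • h‖ ^ 2) / (2 * ‖d‖) := by
    rw [inner_smul_left, h1]
    simp only [conj_trivial]
    field_simp
    ring
  rw [h2, le_div_iff₀ (by positivity)]
  nlinarith [sq_nonneg (‖d‖ - ‖d + s • h‖)]

/-- The first order condition at a vertex that minimizes the length of two edges over a convex
set. -/
lemma inner_le_zero_of_minimal {K : Set E} (hK : Convex ℝ K) {p A B : E} (hpK : p ∈ K)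
    (hA : p - A ≠ 0) (hB : B - p ≠ 0) (hp : ∀ z ∈ K, ‖p - A‖ + ‖B - p‖ ≤ ‖z - A‖ + ‖B - z‖)
    {z : E} (hz : z ∈ K) : ⟪‖B - p‖⁻¹ • (B - p) - ‖p - A‖⁻¹ • (p - A), z - p⟫_ℝ ≤ 0 := by
  set w := ⟪‖B - p‖⁻¹ • (B - p) - ‖p - A‖⁻¹ • (p - A), z - p⟫_ℝ with hw
  set C := ‖z - p‖ ^ 2 / (2 * ‖p - A‖) + ‖z - p‖ ^ 2 / (2 * ‖B - p‖) with hC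
  have key : ∀ s ∈ Set.Ioc (0 : ℝ) 1, w ≤ s * C := by
    intro s hs
    have h1 := norm_add_smul_le (h := z - p) hA s
    have h2 := norm_add_smul_le (h := z - p) hB (-s)
    have h3 := hp (p + s • (z - p)) (hK.add_smul_sub_mem hpK hz ⟨hs.1.le, hs.2⟩)
    rw [show p + s • (z - p) - A = p - A + s • (z - p) by abel,
      show B - (p + s • (z - p)) = B - p + (-s) • (z - p) by rw [neg_smul]; abel] at h3
    have h4 : s * w ≤ s * (s * C) := by
      rw [hw, hC, inner_sub_left]
      nlinarith
    exact le_of_mul_le_mul_left h4 hs.1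
  have hlim : Tendsto (fun s : ℝ => s * C) (𝓝[>] 0) (𝓝 0) :=
    ((continuous_id.mul continuous_const).tendsto' 0 0 (by simp)).mono_left nhdsWithin_le_nhds
  refine ge_of_tendsto hlim ?_
  filter_upwards [Ioc_mem_nhdsGT one_pos] with s hs using key s hs

/-- A shortest path with a proper vertex on a solid tube is reflected at its wall. -/
lemma reflection_of_minimal {L : Submodule ℝ E} {c : ℝ} (hc : 0 < c) {p A B u u' : E}
    (hpK : ‖perp L p‖ ≤ c) (hA : p - A ≠ 0) (hB : B - p ≠ 0)
    (hp : ∀ z, ‖perp L z‖ ≤ c → ‖p - A‖ + ‖B - p‖ ≤ ‖z - A‖ + ‖B - z‖)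
    (hu : u = ‖p - A‖⁻¹ • (p - A)) (hu' : u' = ‖B - p‖⁻¹ • (B - p)) (hne : u' ≠ u) :
    ‖perp L p‖ = c ∧ ⟪perp L p, perp L u⟫_ℝ < 0 ∧
      u' = u - (2 * ⟪perp L p, perp L u⟫_ℝ / c ^ 2) • perp L p := by
  have hconv : Convex ℝ {z | ‖perp L z‖ ≤ c} := by
    have : {z | ‖perp L z‖ ≤ c} = perp L ⁻¹' Metric.closedBall 0 c := by
      ext z
      simp
    rw [this]
    exact (convex_closedBall 0 c).linear_preimage (perp L).toLinearMap
  have hfirst : ∀ z, ‖perp L z‖ ≤ c → ⟪u' - u, z - p⟫_ℝ ≤ 0 := by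
    intro z hz
    rw [hu, hu']
    exact inner_le_zero_of_minimal hconv hpK hA hB hp hz
  set w := u' - u with hw
  have hw0 : 0 < ‖w‖ := norm_pos_iff.2 (sub_ne_zero.2 hne)
  -- the first order condition along `L` shows that `w` is orthogonal to `L`
  have hwp : perp L w = w := by
    have h1 : perp L (p + (w - perp L w)) = perp L p := by
      rw [map_add, map_sub, perp_perp, sub_self, add_zero]
    have h2 := hfirst _ (h1.symm ▸ hpK)
    rw [add_sub_cancel_left, inner_sub_right, inner_perp_right, real_inner_self_eq_norm_sq,
      real_inner_self_eq_norm_sq] at h2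
    have h3 : ‖w - perp L w‖ ^ 2 ≤ 0 := by
      rw [norm_sub_sq_real, inner_perp_right, real_inner_self_eq_norm_sq]
      linarith
    have h4 : ‖w - perp L w‖ = 0 := pow_eq_zero_iff two_ne_zero |>.1 (le_antisymm h3 (sq_nonneg _))
    exact (sub_eq_zero.1 (norm_eq_zero.1 h4)).symm
  -- the first order condition towards the extreme point of the tube in the direction `w`
  have hpe : perp L p = (c / ‖w‖) • w := by
    have h1 : perp L (p - perp L p + (c / ‖w‖) • w) = (c / ‖w‖) • w := by
      rw [map_add, map_sub, perp_perp, sub_self, zero_add, map_smul, hwp]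
    have hnorm : ‖(c / ‖w‖) • w‖ = c := by
      rw [norm_smul, Real.norm_eq_abs, abs_of_pos (div_pos hc hw0), div_mul_cancel₀ _ hw0.ne']
    have h2 := hfirst (p - perp L p + (c / ‖w‖) • w) (by rw [h1, hnorm])
    rw [show p - perp L p + (c / ‖w‖) • w - p = (c / ‖w‖) • w - perp L p by abel,
      inner_sub_right, inner_smul_right, real_inner_self_eq_norm_sq] at h2
    have h3 : ‖perp L p - (c / ‖w‖) • w‖ ^ 2 ≤ 0 := by
      rw [norm_sub_sq_real, hnorm, inner_smul_right, real_inner_comm]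
      have h4 : c / ‖w‖ * ‖w‖ ^ 2 = c * ‖w‖ := by field_simp
      have h5 : c / ‖w‖ * (c * ‖w‖) ≤ c / ‖w‖ * ⟪w, perp L p⟫_ℝ := by
        gcongr
        linarith
      have h6 : c / ‖w‖ * (c * ‖w‖) = c ^ 2 := by field_simp
      have h7 : ‖perp L p‖ ^ 2 ≤ c ^ 2 := by gcongr
      linarith
    have h4 := pow_eq_zero_iff two_ne_zero |>.1 (le_antisymm h3 (sq_nonneg _))
    exact sub_eq_zero.1 (norm_eq_zero.1 h4)
  have hinner : ⟪perp L p, perp L u⟫_ℝ = -(c * ‖w‖ / 2) := by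
    have hnu : ‖u‖ = 1 := by
      rw [hu, norm_smul, norm_inv, norm_norm, inv_mul_cancel₀ (norm_ne_zero_iff.2 hA)]
    have hnu' : ‖u + w‖ = 1 := by
      rw [hw, add_sub_cancel, hu', norm_smul, norm_inv, norm_norm,
        inv_mul_cancel₀ (norm_ne_zero_iff.2 hB)]
    have h1 := norm_add_sq_real u w
    rw [hnu, hnu'] at h1
    rw [← inner_perp_left, hpe, inner_smul_left, real_inner_comm]
    have : ⟪u, w⟫_ℝ = -(‖w‖ ^ 2 / 2) := by linarith
    rw [this]
    simp only [conj_trivial]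
    field_simp
  refine ⟨?_, ?_, ?_⟩
  · rw [hpe, norm_smul, Real.norm_eq_abs, abs_of_pos (div_pos hc hw0), div_mul_cancel₀ _ hw0.ne']
  · rw [hinner]
    exact neg_neg_of_pos (by positivity)
  · rw [hinner, hpe, smul_smul, show 2 * -(c * ‖w‖ / 2) / c ^ 2 * (c / ‖w‖) = -1 by field_simp, hw]
    module

/-- Summation by parts. -/
lemma sum_inner_sub (v z : ℕ → E) (m : ℕ) :
    ∑ i ∈ Finset.range (m + 1), ⟪v i, z (i + 1) - z i⟫_ℝ = ⟪v m, z (m + 1)⟫_ℝ - ⟪v 0, z 0⟫_ℝ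
      - ∑ i ∈ Finset.range m, ⟪v (i + 1) - v i, z (i + 1)⟫_ℝ := by
  induction m with
  | zero => simp [inner_sub_right]
  | succ m ih =>
    rw [Finset.sum_range_succ, ih, Finset.sum_range_succ _ m, inner_sub_right, inner_sub_left]
    ring

lemma IsItinerary.vertex_succ {q : ℝ → E} {a b : ℝ} {n : ℕ} {t : ℕ → ℝ} {v : ℕ → E}
    {L : ℕ → Submodule ℝ E} (h : IsItinerary 𝓛 q a b n t v L) {i : ℕ} (hi : i ≤ n) :
    q (t (i + 1)) = q (t i) + (t (i + 1) - t i) • v i :=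
  h.eq_line i hi _ ⟨(h.lt_succ i hi).le, le_rfl⟩

/-- The edges are transverse to the next collision subspace, since collisions are isolated. -/
lemma IsItinerary.vel_notMem {q : ℝ → E} {a b : ℝ} {n : ℕ} {t : ℕ → ℝ} {v : ℕ → E}
    {L : ℕ → Submodule ℝ E} (h : IsItinerary 𝓛 q a b n t v L) {i : ℕ} (hi : i < n) :
    v i ∉ L (i + 1) := by
  intro hv
  obtain ⟨u, hu⟩ := exists_between (h.lt_succ i hi.le)
  refine h.free i hi.le u hu _ (h.mem i hi) ?_
  have h1 := h.eq_line i hi.le u ⟨hu.1.le, hu.2.le⟩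
  have h2 := h.vertex_succ hi.le
  have h3 : q u = q (t (i + 1)) + (u - t (i + 1)) • v i := by
    rw [h1, h2]
    module
  rw [h3]
  exact add_mem (h.vertex_mem i hi) (Submodule.smul_mem _ _ hv)

/-- The calibration estimate. The velocities `v` of a point billiard trajectory calibrate its
length: a polygon with the same end points and with vertices near the collision subspaces which is
not longer than the trajectory has edges almost parallel to `v`. -/
lemma IsItinerary.sum_norm_sub_inner_le {q : ℝ → E} {a b : ℝ} {n : ℕ} {t : ℕ → ℝ} {v : ℕ → E}
    {L : ℕ → Submodule ℝ E} (h : IsItinerary 𝓛 q a b n t v L) {p : ℕ → E} {c : ℕ → ℝ}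
    (h0 : p 0 = q (t 0)) (hlast : p (n + 1) = q (t (n + 1)))
    (hc : ∀ i < n, ‖perp (L (i + 1)) (p (i + 1))‖ ≤ c (i + 1))
    (hle : polyLength n p ≤ polyLength n fun i => q (t i)) :
    ∑ i ∈ Finset.range (n + 1), (‖p (i + 1) - p i‖ - ⟪v i, p (i + 1) - p i⟫_ℝ)
      ≤ ∑ i ∈ Finset.range n, 2 * c (i + 1) := by
  have hx : polyLength n (fun i => q (t i)) =
      ∑ i ∈ Finset.range (n + 1), ⟪v i, q (t (i + 1)) - q (t i)⟫_ℝ := by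
    refine Finset.sum_congr rfl fun i hi => ?_
    have hi' : i ≤ n := Nat.lt_succ_iff.1 (Finset.mem_range.1 hi)
    have := sub_pos.2 (h.lt_succ i hi')
    change ‖q (t (i + 1)) - q (t i)‖ = _
    rw [h.vertex_succ hi', add_sub_cancel_left, norm_smul, inner_smul_right,
      real_inner_self_eq_norm_sq, h.norm_vel i hi', Real.norm_eq_abs, abs_of_pos this]
    ring
  have hz := sum_inner_sub v (fun i => p i - q (t i)) n
  simp only [h0, hlast, sub_self, inner_zero_right, zero_sub] at hz
  have hsplit : ∑ i ∈ Finset.range (n + 1), ⟪v i, p (i + 1) - q (t (i + 1)) - (p i - q (t i))⟫_ℝ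
      = ∑ i ∈ Finset.range (n + 1), ⟪v i, p (i + 1) - p i⟫_ℝ
        - ∑ i ∈ Finset.range (n + 1), ⟪v i, q (t (i + 1)) - q (t i)⟫_ℝ := by
    rw [← Finset.sum_sub_distrib]
    refine Finset.sum_congr rfl fun i _ => ?_
    rw [← inner_sub_right]
    congr 1
    abel
  have hbound : ∑ i ∈ Finset.range n, ⟪v (i + 1) - v i, p (i + 1) - q (t (i + 1))⟫_ℝ
      ≤ ∑ i ∈ Finset.range n, 2 * c (i + 1) := by
    refine Finset.sum_le_sum fun i hi => ?_
    have hi' := Finset.mem_range.1 hi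
    have hperp : perp (L (i + 1)) (v (i + 1) - v i) = v (i + 1) - v i := by
      rw [perp_apply, map_sub, h.proj_vel i hi', sub_self, sub_zero]
    have hq := perp_eq_zero_iff.2 (h.vertex_mem i hi')
    rw [← hperp, inner_perp_left, hperp, map_sub, hq, sub_zero]
    refine (real_inner_le_norm _ _).trans ?_
    have h1 : ‖v (i + 1) - v i‖ ≤ 2 := by
      refine (norm_sub_le _ _).trans ?_
      rw [h.norm_vel _ hi', h.norm_vel _ hi'.le]
      norm_num
    have h2 := hc i hi'
    gcongr
  rw [Finset.sum_sub_distrib]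
  simp only [polyLength] at hle hx
  linarith

/-! ### Convergence of the shortest polygons -/

/-- A sequence of vectors almost parallel to the unit vector `v`, in the sense of
`‖d‖ - ⟪v, d⟫ → 0`, is close to its projection to the line spanned by `v`. -/
lemma tendsto_sub_inner_smul {F : Filter ℝ} {d : ℝ → E} {v : E} {M : ℝ} (hv : ‖v‖ = 1)
    (hM : ∀ᶠ r in F, ‖d r‖ ≤ M) (hd : Tendsto (fun r => ‖d r‖ - ⟪v, d r⟫_ℝ) F (𝓝 0)) :
    Tendsto (fun r => d r - ⟪v, d r⟫_ℝ • v) F (𝓝 0) := by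
  have hsq : Tendsto (fun r => (‖d r‖ - ⟪v, d r⟫_ℝ) * (2 * M)) F (𝓝 0) := by
    simpa using hd.mul_const (2 * M)
  have hsqrt : Tendsto (fun r => √((‖d r‖ - ⟪v, d r⟫_ℝ) * (2 * M))) F (𝓝 0) := by
    simpa using hsq.sqrt
  refine squeeze_zero_norm' ?_ hsqrt
  filter_upwards [hM] with r hr
  refine Real.le_sqrt_of_sq_le ?_
  have h1 : ⟪v, d r⟫_ℝ ≤ ‖d r‖ := by
    simpa [hv] using real_inner_le_norm v (d r)
  rw [norm_sub_sq_real, inner_smul_right, norm_smul, hv, real_inner_comm v, Real.norm_eq_abs,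
    mul_one, sq_abs]
  nlinarith [mul_nonneg (sub_nonneg.2 h1) (show 0 ≤ 2 * M - ‖d r‖ - ⟪v, d r⟫_ℝ by linarith)]

variable {q : ℝ → E} {a b : ℝ} {n : ℕ} {t : ℕ → ℝ} {v : ℕ → E} {L : ℕ → Submodule ℝ E}

/-- By the calibration estimate, the polygons that are not longer than the trajectory converge to it
as their vertices approach the collision subspaces. -/
lemma IsItinerary.tendsto_vertex (h : IsItinerary 𝓛 q a b n t v L) {p : ℝ → ℕ → E}
    (h0 : ∀ r > 0, p r 0 = q (t 0)) (hlast : ∀ r > 0, p r (n + 1) = q (t (n + 1)))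
    (hc : ∀ r > 0, ∀ i < n, ‖perp (L (i + 1)) (p r (i + 1))‖ ≤ σ (L (i + 1)) * r)
    (hle : ∀ r > 0, polyLength n (p r) ≤ polyLength n fun i => q (t i)) {i : ℕ} (hi : i ≤ n + 1) :
    Tendsto (fun r => p r i) (𝓝[>] 0) (𝓝 (q (t i))) := by
  have hpos : ∀ᶠ r : ℝ in 𝓝[>] 0, 0 < r := eventually_mem_nhdsWithin
  have hid : Tendsto (fun r : ℝ => r) (𝓝[>] 0) (𝓝 0) := tendsto_id.mono_left nhdsWithin_le_nhds
  have hnonneg : ∀ r, ∀ j ≤ n, 0 ≤ ‖p r (j + 1) - p r j‖ - ⟪v j, p r (j + 1) - p r j⟫_ℝ := by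
    intro r j hj
    have := real_inner_le_norm (v j) (p r (j + 1) - p r j)
    rw [h.norm_vel j hj, one_mul] at this
    linarith
  have hdefect : ∀ j ≤ n, Tendsto
      (fun r => ‖p r (j + 1) - p r j‖ - ⟪v j, p r (j + 1) - p r j⟫_ℝ) (𝓝[>] 0) (𝓝 0) := by
    intro j hj
    have hlim : Tendsto (fun r => ∑ i ∈ Finset.range n, 2 * (σ (L (i + 1)) * r)) (𝓝[>] 0)
        (𝓝 0) := by
      have : Continuous fun r : ℝ => ∑ i ∈ Finset.range n, 2 * (σ (L (i + 1)) * r) := by fun_prop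
      exact (this.tendsto' 0 0 (by simp)).mono_left nhdsWithin_le_nhds
    refine squeeze_zero' (Eventually.of_forall fun r => hnonneg r j hj) ?_ hlim
    filter_upwards [hpos] with r hr
    refine le_trans ?_ (h.sum_norm_sub_inner_le (c := fun i => σ (L i) * r) (h0 r hr) (hlast r hr)
      (hc r hr) (hle r hr))
    exact Finset.single_le_sum (f := fun j => ‖p r (j + 1) - p r j‖ - ⟪v j, p r (j + 1) - p r j⟫_ℝ)
      (fun k hk => hnonneg r k (Nat.lt_succ_iff.1 (Finset.mem_range.1 hk)))
      (Finset.mem_range.2 (Nat.lt_succ_iff.2 hj))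
  have hbdd : ∀ j ≤ n, ∀ᶠ r in 𝓝[>] 0, ‖p r (j + 1) - p r j‖ ≤ polyLength n fun i => q (t i) := by
    intro j hj
    filter_upwards [hpos] with r hr
    refine le_trans ?_ (hle r hr)
    exact Finset.single_le_sum (f := fun j => ‖p r (j + 1) - p r j‖) (fun _ _ => norm_nonneg _)
      (Finset.mem_range.2 (Nat.lt_succ_iff.2 hj))
  induction i with
  | zero => exact tendsto_const_nhds.congr' (hpos.mono fun r hr => (h0 r hr).symm)
  | succ i ih =>
    replace ih := ih (by omega)
    have hin : i ≤ n := by omega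
    rcases hin.lt_or_eq with hlt | rfl
    · set P := perp (L (i + 1)) with hP
      have he := tendsto_sub_inner_smul (h.norm_vel i hin) (hbdd i hin) (hdefect i hin)
      set d : ℝ → E := fun r => p r (i + 1) - p r i with hd
      set l : ℝ → ℝ := fun r => ⟪v i, d r⟫_ℝ with hl
      have hPv : P (v i) ≠ 0 := fun h0 => h.vel_notMem hlt (perp_eq_zero_iff.1 h0)
      have hPp : Tendsto (fun r => P (p r (i + 1))) (𝓝[>] 0) (𝓝 0) := by
        refine squeeze_zero_norm' (hpos.mono fun r hr => hc r hr i hlt) ?_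
        simpa using hid.const_mul (σ (L (i + 1)))
      -- transversality: the lengths of the edges are determined by their components orthogonal to
      -- the next collision subspace
      have hlP : Tendsto (fun r => l r • P (v i)) (𝓝[>] 0)
          (𝓝 ((t (i + 1) - t i) • P (v i))) := by
        have h1 : (t (i + 1) - t i) • P (v i) = 0 - P (q (t i)) - P 0 := by
          have h2 := perp_eq_zero_iff.2 (h.vertex_mem i hlt)
          rw [h.vertex_succ hin, map_add, map_smul] at h2
          rw [map_zero, sub_zero, zero_sub]
          exact eq_neg_of_add_eq_zero_right h2
        rw [h1]
        refine ((hPp.sub ((P.continuous.tendsto _).comp ih)).sub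
          ((P.continuous.tendsto _).comp he)).congr fun r => ?_
        simp only [Function.comp_apply, hd, hl, map_sub, map_smul]
        abel
      have hl' : Tendsto l (𝓝[>] 0) (𝓝 (t (i + 1) - t i)) := by
        have h1 := (hlP.inner (tendsto_const_nhds (x := P (v i)))).div_const (‖P (v i)‖ ^ 2)
        have h2 : ∀ k : ℝ, ⟪k • P (v i), P (v i)⟫_ℝ / ‖P (v i)‖ ^ 2 = k := by
          intro k
          rw [inner_smul_left, real_inner_self_eq_norm_sq]
          exact mul_div_cancel_right₀ _ (pow_ne_zero 2 (norm_ne_zero_iff.2 hPv))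
        simpa only [h2] using h1
      have h3 := (ih.add he).add (hl'.smul_const (v i))
      rw [add_zero, ← h.vertex_succ hin] at h3
      refine h3.congr fun r => ?_
      simp only [hd, hl]
      abel
    · exact tendsto_const_nhds.congr' (hpos.mono fun r hr => (hlast r hr).symm)

/-! ### Shadowing on a bounded interval -/

/-- The motions after successive reflections in tubes with radii `c i` around `L i`, `i ≥ 1`. -/
noncomputable def reflections (L : ℕ → Submodule ℝ E) (c : ℕ → ℝ) (s : E × E) : ℕ → E × E
  | 0 => s
  | i + 1 => reflectLine (L (i + 1)) (c (i + 1)) (reflections L c s i)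

/-- The motion `s` and its successive reflections in the tubes of radii `c i` around `L i` follow
the polygon with vertices `x i` at the times `t i`, with an error less than `δ`. -/
structure IsShadow (n : ℕ) (t : ℕ → ℝ) (x : ℕ → E) (L : ℕ → Submodule ℝ E) (c : ℕ → ℝ) (δ : ℝ)
    (s : E × E) : Prop where
  disc_pos : ∀ i < n, 0 < disc (L (i + 1)) (c (i + 1)) (reflections L c s i)
  time : ∀ i < n, |entryTime (L (i + 1)) (c (i + 1)) (reflections L c s i) - t (i + 1)| < δ
  point : ∀ i < n, ‖pos (reflections L c s i)
    (entryTime (L (i + 1)) (c (i + 1)) (reflections L c s i)) - x (i + 1)‖ < δ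
  start : ‖pos s (t 0) - x 0‖ < δ
  finish : ‖pos (reflections L c s n) (t (n + 1)) - x (n + 1)‖ < δ

/-- Shortest polygons give motions shadowing a point billiard trajectory. -/
lemma IsItinerary.eventually_exists_isShadow (h : IsItinerary 𝓛 q a b n t v L)
    (hσ : ∀ L ∈ 𝓛, 0 < σ L) {δ : ℝ} (hδ : 0 < δ) :
    ∀ᶠ r in 𝓝[>] 0, ∃ s : E × E, ‖s.2‖ = 1 ∧
      IsShadow n t (fun i => q (t i)) L (fun i => σ (L i) * r) δ s := by
  classical
  have hpos : ∀ᶠ r : ℝ in 𝓝[>] 0, 0 < r := eventually_mem_nhdsWithin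
  -- the minimizers
  let K : ℝ → ℕ → Set E := fun r i => if 1 ≤ i ∧ i ≤ n then tube σ r (L i) else {q (t i)}
  have hKtube : ∀ r, ∀ i < n, K r (i + 1) = tube σ r (L (i + 1)) := fun r i hi =>
    if_pos ⟨by omega, hi⟩
  have hmin : ∀ r, ∃ p : ℕ → E, 0 < r → (∀ i, p i ∈ K r i) ∧
      (∀ p' : ℕ → E, (∀ i, p' i ∈ K r i) → polyLength n p ≤ polyLength n p') ∧
      polyLength n p ≤ polyLength n fun i => q (t i) := by
    intro r
    by_cases hr : 0 < r
    · have hx : ∀ i, q (t i) ∈ K r i := by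
        intro i
        by_cases hi : 1 ≤ i ∧ i ≤ n
        · obtain ⟨j, rfl⟩ := Nat.exists_eq_add_of_le' hi.1
          rw [hKtube r j hi.2, mem_tube_iff, perp_eq_zero_iff.2 (h.vertex_mem j hi.2), norm_zero]
          exact (mul_pos (hσ _ (h.mem j hi.2)) hr).le
        · simp [K, hi]
      obtain ⟨p, hp1, hp2⟩ := exists_minimal_polyLength (n := n) (K := K r) (x := fun i => q (t i))
        (fun i => by
          simp only [K]
          split_ifs
          exacts [isClosed_tube _ _ _, isClosed_singleton]) hx (by simp [K])
        (fun i hi => by simp [K, not_le.2 hi])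
      exact ⟨p, fun _ => ⟨hp1, hp2, hp2 _ hx⟩⟩
    · exact ⟨0, fun h => absurd h hr⟩
  choose p hp using hmin
  have hlim : ∀ i ≤ n + 1, Tendsto (fun r => p r i) (𝓝[>] 0) (𝓝 (q (t i))) := by
    intro i hi
    refine h.tendsto_vertex (σ := σ) (p := p) (fun r hr => ?_) (fun r hr => ?_)
      (fun r hr i hi => ?_) (fun r hr => (hp r hr).2.2) hi
    · simpa [K] using (hp r hr).1 0
    · simpa [K] using (hp r hr).1 (n + 1)
    · have := (hp r hr).1 (i + 1)
      rwa [hKtube r i hi, mem_tube_iff] at this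
  -- edges, directions and times
  let d : ℝ → ℕ → E := fun r i => p r (i + 1) - p r i
  let u : ℝ → ℕ → E := fun r i => ‖d r i‖⁻¹ • d r i
  let θ : ℝ → ℕ → ℝ := fun r i => t 0 + ∑ j ∈ Finset.range i, ‖d r j‖
  have hd : ∀ i ≤ n, Tendsto (fun r => d r i) (𝓝[>] 0) (𝓝 ((t (i + 1) - t i) • v i)) := by
    intro i hi
    have := (hlim (i + 1) (by omega)).sub (hlim i (by omega))
    rwa [h.vertex_succ hi, add_sub_cancel_left] at this
  have hnd : ∀ i ≤ n, Tendsto (fun r => ‖d r i‖) (𝓝[>] 0) (𝓝 (t (i + 1) - t i)) := by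
    intro i hi
    have := (hd i hi).norm
    rwa [norm_smul, h.norm_vel i hi, mul_one, Real.norm_eq_abs,
      abs_of_pos (sub_pos.2 (h.lt_succ i hi))] at this
  have hu : ∀ i ≤ n, Tendsto (fun r => u r i) (𝓝[>] 0) (𝓝 (v i)) := by
    intro i hi
    have hne := (sub_pos.2 (h.lt_succ i hi)).ne'
    have := ((hnd i hi).inv₀ hne).smul (hd i hi)
    rwa [smul_smul, inv_mul_cancel₀ hne, one_smul] at this
  have hθ : ∀ i ≤ n + 1, Tendsto (fun r => θ r i) (𝓝[>] 0) (𝓝 (t i)) := by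
    intro i hi
    have h1 : t i = t 0 + ∑ j ∈ Finset.range i, (t (j + 1) - t j) := by
      rw [Finset.sum_range_sub, add_sub_cancel]
    rw [h1]
    refine tendsto_const_nhds.add (tendsto_finsetSum _ fun j hj => hnd j ?_)
    have := Finset.mem_range.1 hj
    omega
  -- the reflection law holds as soon as the edges are close to those of the trajectory
  have hE1 : ∀ᶠ r in 𝓝[>] 0, ∀ i ∈ Finset.range (n + 1), d r i ≠ 0 := by
    rw [eventually_all_finset]
    intro i hi
    have hi' := Nat.lt_succ_iff.1 (Finset.mem_range.1 hi)
    filter_upwards [(hnd i hi').eventually_ne (sub_pos.2 (h.lt_succ i hi')).ne'] with r hr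
    exact norm_ne_zero_iff.1 hr
  have hE2 : ∀ᶠ r in 𝓝[>] 0, ∀ i ∈ Finset.range n, u r (i + 1) ≠ u r i := by
    rw [eventually_all_finset]
    intro i hi
    have hi' := Finset.mem_range.1 hi
    have := ((hu (i + 1) hi').sub (hu i hi'.le)).eventually_ne (sub_ne_zero.2 (h.vel_ne i hi'))
    filter_upwards [this] with r hr using sub_ne_zero.1 hr
  have hE3 : ∀ᶠ r in 𝓝[>] 0, ∀ i ∈ Finset.range (n + 2), dist (θ r i) (t i) < δ ∧
      dist (p r i) (q (t i)) < δ := by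
    rw [eventually_all_finset]
    intro i hi
    have hi' : i ≤ n + 1 := Nat.lt_succ_iff.1 (Finset.mem_range.1 hi)
    exact ((hθ i hi').eventually (Metric.ball_mem_nhds _ hδ)).and
      ((hlim i hi').eventually (Metric.ball_mem_nhds _ hδ))
  have hE4 : ∀ᶠ r in 𝓝[>] 0, ‖p r n + (t (n + 1) - θ r n) • u r n - q (t (n + 1))‖ < δ := by
    have h1 := (hlim n (by omega)).add
      (((tendsto_const_nhds (x := t (n + 1))).sub (hθ n (by omega))).smul (hu n le_rfl))
    rw [← h.vertex_succ le_rfl] at h1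
    filter_upwards [h1.eventually (Metric.ball_mem_nhds _ hδ)] with r hr
    rwa [dist_eq_norm] at hr
  filter_upwards [hpos, hE1, hE2, hE3, hE4] with r hr h1 h2 h3 h4
  obtain ⟨hpK, hpmin, -⟩ := hp r hr
  let S : ℕ → E × E := fun i => (p r i - θ r i • u r i, u r i)
  have hposS : ∀ i x, pos (S i) x = p r i + (x - θ r i) • u r i := by
    intro i x
    simp only [S, pos]
    module
  have hposS1 : ∀ i ≤ n, pos (S i) (θ r (i + 1)) = p r (i + 1) := by
    intro i hi
    have hne := h1 i (Finset.mem_range.2 (by omega))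
    have e1 : θ r (i + 1) - θ r i = ‖d r i‖ := by
      simp only [θ, Finset.sum_range_succ]
      ring
    rw [hposS, e1]
    simp only [u]
    rw [smul_smul, mul_inv_cancel₀ (norm_ne_zero_iff.2 hne), one_smul]
    simp only [d]
    abel
  have hrefl : ∀ i < n, ‖perp (L (i + 1)) (pos (S i) (θ r (i + 1)))‖ = σ (L (i + 1)) * r ∧
      ⟪perp (L (i + 1)) (pos (S i) (θ r (i + 1))), perp (L (i + 1)) (S i).2⟫_ℝ < 0 ∧
      reflectLine (L (i + 1)) (σ (L (i + 1)) * r) (S i) = S (i + 1) := by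
    intro i hi
    have hpi := hpK (i + 1)
    rw [hKtube r i hi, mem_tube_iff] at hpi
    obtain ⟨e1, e2, e3⟩ := reflection_of_minimal (L := L (i + 1)) (A := p r i) (B := p r (i + 2))
      (u := u r i) (u' := u r (i + 1))
      (mul_pos (hσ _ (h.mem i hi)) hr) hpi (h1 i (Finset.mem_range.2 (by omega)))
      (h1 (i + 1) (Finset.mem_range.2 (by omega)))
      (fun z hz => two_edges_le_of_minimal hpK hpmin hi
        (by rw [hKtube r i hi]; exact mem_tube_iff.2 hz)) rfl rfl
      (h2 i (Finset.mem_range.2 hi))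
    rw [← hposS1 i hi.le] at e1 e2 e3
    refine ⟨e1, e2, ?_⟩
    rw [reflectLine_eq e1 e2 e3, hposS1 i hi.le]
  have hreflS : ∀ i ≤ n, reflections L (fun i => σ (L i) * r) (S 0) i = S i := by
    intro i hi
    induction i with
    | zero => rfl
    | succ i ih => rw [reflections, ih (by omega), (hrefl i hi).2.2]
  refine ⟨S 0, ?_, fun i hi => ?_, fun i hi => ?_, fun i hi => ?_, ?_, ?_⟩
  · simp only [S, u]
    rw [norm_smul, norm_inv, norm_norm, inv_mul_cancel₀]
    exact norm_ne_zero_iff.2 (h1 0 (Finset.mem_range.2 (by omega)))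
  · rw [hreflS i hi.le]
    exact (entry_of_inner_neg (hrefl i hi).1 (hrefl i hi).2.1).1
  · rw [hreflS i hi.le, (entry_of_inner_neg (hrefl i hi).1 (hrefl i hi).2.1).2.1]
    exact (h3 (i + 1) (Finset.mem_range.2 (by omega))).1
  · rw [hreflS i hi.le, (entry_of_inner_neg (hrefl i hi).1 (hrefl i hi).2.1).2.1, hposS1 i hi.le,
      ← dist_eq_norm]
    exact (h3 (i + 1) (Finset.mem_range.2 (by omega))).2
  · have : θ r 0 = t 0 := by simp [θ]
    rw [hposS, this, sub_self, zero_smul, add_zero, ← dist_eq_norm]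
    exact (h3 0 (Finset.mem_range.2 (by omega))).2
  · rw [hreflS n le_rfl, hposS]
    exact h4

lemma continuousAt_reflections {c : ℕ → ℝ} {s : E × E} {m : ℕ}
    (h : ∀ i < m, 0 < disc (L (i + 1)) (c (i + 1)) (reflections L c s i)) :
    ContinuousAt (fun s => reflections L c s m) s := by
  induction m with
  | zero => exact continuousAt_id
  | succ m ih =>
    exact ContinuousAt.comp (g := reflectLine (L (m + 1)) (c (m + 1)))
      (continuousAt_reflectLine (h m (Nat.lt_succ_self m))) (ih fun i hi => h i (by omega))

lemma IsShadow.eventually {x : ℕ → E} {c : ℕ → ℝ} {δ : ℝ} {s : E × E}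
    (h : IsShadow n t x L c δ s) : ∀ᶠ s' in 𝓝 s, IsShadow n t x L c δ s' := by
  have hc : ∀ i ≤ n, ContinuousAt (fun s => reflections L c s i) s := fun i hi =>
    continuousAt_reflections fun j hj => h.disc_pos j (by omega)
  have hτ : ∀ i < n, ContinuousAt
      (fun s => entryTime (L (i + 1)) (c (i + 1)) (reflections L c s i)) s := fun i hi =>
    ContinuousAt.comp (g := entryTime (L (i + 1)) (c (i + 1)))
      (continuousAt_entryTime (h.disc_pos i hi)) (hc i hi.le)
  have h1 : ∀ᶠ s' in 𝓝 s, ∀ i ∈ Finset.range n,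
      0 < disc (L (i + 1)) (c (i + 1)) (reflections L c s' i) ∧
      |entryTime (L (i + 1)) (c (i + 1)) (reflections L c s' i) - t (i + 1)| < δ ∧
      ‖pos (reflections L c s' i)
        (entryTime (L (i + 1)) (c (i + 1)) (reflections L c s' i)) - x (i + 1)‖ < δ := by
    rw [eventually_all_finset]
    intro i hi
    have hi' := Finset.mem_range.1 hi
    have c1 := hc i hi'.le
    have c2 := hτ i hi'
    refine Eventually.and ?_ (Eventually.and ?_ ?_)
    · exact (((continuous_disc _ _).continuousAt.comp c1).eventually_const_lt (h.disc_pos i hi') :)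
    · exact ((c2.sub_const _).abs.eventually_lt_const (h.time i hi') :)
    · refine Tendsto.eventually_lt_const (h.point i hi') (ContinuousAt.tendsto ?_)
      unfold pos
      fun_prop
  have c0 := hc n le_rfl
  have h2 : ∀ᶠ s' in 𝓝 s, ‖pos s' (t 0) - x 0‖ < δ := by
    refine Tendsto.eventually_lt_const h.start (ContinuousAt.tendsto ?_)
    unfold pos
    fun_prop
  have h3 : ∀ᶠ s' in 𝓝 s, ‖pos (reflections L c s' n) (t (n + 1)) - x (n + 1)‖ < δ := by
    refine Tendsto.eventually_lt_const h.finish (ContinuousAt.tendsto ?_)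
    unfold pos
    fun_prop
  filter_upwards [h1, h2, h3] with s' h1 h2 h3
  exact ⟨fun i hi => (h1 i (Finset.mem_range.2 hi)).1,
    fun i hi => (h1 i (Finset.mem_range.2 hi)).2.1,
    fun i hi => (h1 i (Finset.mem_range.2 hi)).2.2, h2, h3⟩

/-- The closed edges of the polygon stay at distance at least `2 * δ` from each collision subspace
that they do not meet, and so do the vertices; the edges are longer than `2 * δ`. -/
structure IsClearance (𝓛 : Finset (Submodule ℝ E)) (q : ℝ → E) (n : ℕ) (t : ℕ → ℝ) (δ : ℝ) :
    Prop where
  edge : ∀ k ≤ n, ∀ L' ∈ 𝓛, (∀ u ∈ Set.Icc (t k) (t (k + 1)), q u ∉ L') →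
    ∀ u ∈ Set.Icc (t k) (t (k + 1)), 2 * δ ≤ ‖perp L' (q u)‖
  vertex : ∀ i ≤ n + 1, ∀ L' ∈ 𝓛, q (t i) ∉ L' → 2 * δ ≤ ‖perp L' (q (t i))‖
  length : ∀ k ≤ n, 2 * δ < t (k + 1) - t k

lemma eventually_two_mul_lt {η : ℝ} (hη : 0 < η) : ∀ᶠ δ : ℝ in 𝓝[>] 0, 2 * δ < η := by
  filter_upwards [Ioo_mem_nhdsGT (half_pos hη)] with δ hδ
  linarith [hδ.2]

lemma IsItinerary.eventually_isClearance (h : IsItinerary 𝓛 q a b n t v L) (hq : Continuous q) :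
    ∀ᶠ δ in 𝓝[>] 0, IsClearance 𝓛 q n t δ := by
  have h1 : ∀ᶠ δ in 𝓝[>] 0, ∀ k ∈ Finset.range (n + 1), ∀ L' ∈ 𝓛,
      (∀ u ∈ Set.Icc (t k) (t (k + 1)), q u ∉ L') →
        ∀ u ∈ Set.Icc (t k) (t (k + 1)), 2 * δ ≤ ‖perp L' (q u)‖ := by
    rw [eventually_all_finset]
    intro k hk
    rw [eventually_all_finset]
    intro L' _
    by_cases hm : ∀ u ∈ Set.Icc (t k) (t (k + 1)), q u ∉ L'
    · have hle := (h.lt_succ k (Nat.lt_succ_iff.1 (Finset.mem_range.1 hk))).le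
      obtain ⟨u₀, hu₀, hmin⟩ := isCompact_Icc.exists_isMinOn (Set.nonempty_Icc.2 hle)
        (f := fun u => ‖perp L' (q u)‖) (by fun_prop)
      have hpos : 0 < ‖perp L' (q u₀)‖ :=
        norm_pos_iff.2 fun h0 => hm u₀ hu₀ (perp_eq_zero_iff.1 h0)
      filter_upwards [eventually_two_mul_lt hpos] with δ hδ _ u hu
      exact hδ.le.trans (hmin hu)
    · exact Eventually.of_forall fun _ h => absurd h hm
  have h2 : ∀ᶠ δ in 𝓝[>] 0, ∀ i ∈ Finset.range (n + 2), ∀ L' ∈ 𝓛, q (t i) ∉ L' →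
      2 * δ ≤ ‖perp L' (q (t i))‖ := by
    rw [eventually_all_finset]
    intro i _
    rw [eventually_all_finset]
    intro L' _
    by_cases hm : q (t i) ∈ L'
    · exact Eventually.of_forall fun _ h => absurd hm h
    · have hpos : 0 < ‖perp L' (q (t i))‖ := norm_pos_iff.2 fun h0 => hm (perp_eq_zero_iff.1 h0)
      filter_upwards [eventually_two_mul_lt hpos] with δ hδ _ using hδ.le
  have h3 : ∀ᶠ δ : ℝ in 𝓝[>] 0, ∀ k ∈ Finset.range (n + 1), 2 * δ < t (k + 1) - t k := by
    rw [eventually_all_finset]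
    intro k hk
    exact eventually_two_mul_lt
      (sub_pos.2 (h.lt_succ k (Nat.lt_succ_iff.1 (Finset.mem_range.1 hk))))
  filter_upwards [h1, h2, h3] with δ h1 h2 h3
  exact ⟨fun k hk => h1 k (Finset.mem_range.2 (by omega)),
    fun i hi => h2 i (Finset.mem_range.2 (by omega)),
    fun k hk => h3 k (Finset.mem_range.2 (by omega))⟩

/-- Two uniform motions on neighbouring time intervals whose end points are close stay close, up to
a small change of time. -/
lemma exists_close_of_endpoints_close {s : E × E} {v : E} {τ τ' t t' δ u : ℝ}
    (hτ : τ < τ') (htt : t < t')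
    (hq : ∀ u ∈ Set.Icc t t', q u = q t + (u - t) • v) (h1 : |τ - t| ≤ δ) (h2 : |τ' - t'| ≤ δ)
    (h3 : ‖pos s τ - q t‖ ≤ δ) (h4 : ‖pos s τ' - q t'‖ ≤ δ) (hu : u ∈ Set.Icc τ τ') :
    ∃ u' ∈ Set.Icc t t', |u - u'| ≤ δ ∧ ‖pos s u - q u'‖ ≤ δ := by
  set k := (u - τ) / (τ' - τ) with hk
  have hd : 0 < τ' - τ := sub_pos.2 hτ
  have hk0 : 0 ≤ k := div_nonneg (sub_nonneg.2 hu.1) hd.le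
  have hk1 : k ≤ 1 := (div_le_one hd).2 (by linarith [hu.2])
  have huk : u = τ + k * (τ' - τ) := by
    rw [hk, div_mul_cancel₀ _ hd.ne']
    ring
  have hmem : t + k * (t' - t) ∈ Set.Icc t t' := by
    have : 0 < t' - t := sub_pos.2 htt
    constructor <;> nlinarith
  refine ⟨t + k * (t' - t), hmem, ?_, ?_⟩
  · have e : u - (t + k * (t' - t)) = (1 - k) * (τ - t) + k * (τ' - t') := by
      rw [huk]
      ring
    rw [e]
    refine (abs_add_le _ _).trans ?_
    rw [abs_mul, abs_mul, abs_of_nonneg hk0, abs_of_nonneg (sub_nonneg.2 hk1)]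
    nlinarith
  · have e : pos s u - q (t + k * (t' - t)) =
        (1 - k) • (pos s τ - q t) + k • (pos s τ' - q t') := by
      rw [hq _ hmem, hq t' ⟨htt.le, le_rfl⟩, huk]
      simp only [pos]
      module
    rw [e]
    refine (norm_add_le _ _).trans ?_
    rw [norm_smul, norm_smul, Real.norm_eq_abs, Real.norm_eq_abs, abs_of_nonneg hk0,
      abs_of_nonneg (sub_nonneg.2 hk1)]
    nlinarith

lemma exists_mem_Icc_succ {τ : ℕ → ℝ} {m : ℕ} (hm : 0 < m) {u : ℝ}
    (hu : u ∈ Set.Icc (τ 0) (τ m)) : ∃ k < m, u ∈ Set.Icc (τ k) (τ (k + 1)) := by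
  induction m with
  | zero => exact absurd hm (lt_irrefl _)
  | succ m ih =>
    rcases le_total (τ m) u with h | h
    · exact ⟨m, Nat.lt_succ_self m, h, hu.2⟩
    · rcases Nat.eq_zero_or_pos m with rfl | hm'
      · exact ⟨0, hm, hu⟩
      · obtain ⟨k, hk, hk'⟩ := ih hm' ⟨hu.1, h⟩
        exact ⟨k, by omega, hk'⟩

/-- A generic motion that shadows a point billiard trajectory up to the clearance belongs to a
thickened trajectory. -/
lemma IsItinerary.exists_isThickenedTrajectory (h : IsItinerary 𝓛 q a b n t v L) {δ ε : ℝ}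
    (hδ : 0 < δ) (hcl : IsClearance 𝓛 q n t δ) (hσ : ∀ L ∈ 𝓛, 0 < σ L * r)
    (hσδ : ∀ L ∈ 𝓛, σ L * r < δ) {s : E × E} (hs : ‖s.2‖ = 1) (hg : IsGeneric 𝓛 σ r s)
    (hg' : IsGeneric 𝓛 σ r (rev s))
    (hsh : IsShadow n t (fun i => q (t i)) L (fun i => σ (L i) * r) δ s)
    (hmod : ∀ u ∈ Set.Icc a b, ∀ u' ∈ Set.Icc a b, |u - u'| ≤ δ → ‖q u - q u'‖ ≤ ε) :
    ∃ Q : C(ℝ, E), IsThickenedTrajectory 𝓛 σ r Q ∧ ∀ u ∈ Set.Icc a b, ‖Q u - q u‖ ≤ δ + ε := by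
  set R := reflections L (fun i => σ (L i) * r) s with hR
  let S : ℕ → E × E := fun k => R (min k n)
  let τ : ℕ → ℝ
    | 0 => t 0
    | k + 1 => if k < n then entryTime (L (k + 1)) (σ (L (k + 1)) * r) (R k) else t (n + 1)
  have hS : ∀ k ≤ n, S k = R k := fun k hk => by simp only [S, min_eq_left hk]
  have hSlast : S (n + 1) = R n := by simp [S]
  have hSsucc : ∀ k < n, S (k + 1) = reflectLine (L (k + 1)) (σ (L (k + 1)) * r) (R k) :=
    fun k hk => hS (k + 1) hk
  have hτsucc : ∀ k < n, τ (k + 1) = entryTime (L (k + 1)) (σ (L (k + 1)) * r) (R k) :=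
    fun k hk => by simp [τ, hk]
  have hτlast : τ (n + 1) = t (n + 1) := by simp [τ]
  have hτt : ∀ k ≤ n + 1, |τ k - t k| < δ := by
    intro k hk
    rcases k with - | k
    · simpa [τ] using hδ
    · rcases (Nat.succ_le_succ_iff.1 hk).lt_or_eq with hk' | rfl
      · rw [hτsucc k hk']
        exact hsh.time k hk'
      · simpa [hτlast] using hδ
  have hend : ∀ k ≤ n, ‖pos (S k) (τ (k + 1)) - q (t (k + 1))‖ < δ := by
    intro k hk
    rw [hS k hk]
    rcases hk.lt_or_eq with hk' | rfl
    · rw [hτsucc k hk']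
      exact hsh.point k hk'
    · rw [hτlast]
      exact hsh.finish
  have hglue : ∀ k ≤ n, pos (S k) (τ (k + 1)) = pos (S (k + 1)) (τ (k + 1)) := by
    intro k hk
    rcases hk.lt_or_eq with hk' | rfl
    · rw [hτsucc k hk', hSsucc k hk', hS k hk, pos_reflectLine]
    · rw [hS k le_rfl, hSlast]
  have hbeg : ∀ k ≤ n, ‖pos (S k) (τ k) - q (t k)‖ < δ := by
    intro k hk
    rcases k with - | k
    · exact hsh.start
    · rw [← hglue k (by omega)]
      exact hend k (by omega)
  have hτlt : ∀ k ≤ n, τ k < τ (k + 1) := by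
    intro k hk
    have h1 := abs_lt.1 (hτt k (by omega))
    have h2 := abs_lt.1 (hτt (k + 1) (by omega))
    have h3 := hcl.length k hk
    linarith
  have hclose : ∀ k ≤ n, ∀ u ∈ Set.Icc (τ k) (τ (k + 1)), ∃ u' ∈ Set.Icc (t k) (t (k + 1)),
      |u - u'| ≤ δ ∧ ‖pos (S k) u - q u'‖ ≤ δ := fun k hk u hu =>
    exists_close_of_endpoints_close (hτlt k hk) (h.lt_succ k hk) (h.eq_line k hk)
      (hτt k (by omega)).le (hτt (k + 1) (by omega)).le (hbeg k hk).le (hend k hk).le hu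
  have hout : ∀ L' ∈ 𝓛, ∀ x y : E, ‖x - y‖ ≤ δ → 2 * δ ≤ ‖perp L' y‖ → x ∉ tube σ r L' := by
    intro L' hL' x y hxy hy hx
    rw [mem_tube_iff] at hx
    have h1 : ‖perp L' y‖ ≤ ‖perp L' x‖ + ‖x - y‖ := by
      have := norm_sub_le (perp L' x) (perp L' (x - y))
      rw [← map_sub, sub_sub_cancel] at this
      exact this.trans (add_le_add_right (norm_perp_le _ _) _)
    linarith [hσδ L' hL']
  have hvertex : ∀ k ≤ n, ∀ L' ∈ 𝓛, q (t (k + 1)) ∉ L' → pos (S k) (τ (k + 1)) ∉ tube σ r L' :=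
    fun k hk L' hL' hm => hout L' hL' _ _ (hend k hk).le (hcl.vertex (k + 1) (by omega) L' hL' hm)
  have hstart : ∀ L' ∈ 𝓛, pos (S 0) (τ 0) ∉ tube σ r L' := by
    refine fun L' hL' => hout L' hL' _ _ (hbeg 0 n.zero_le).le (hcl.vertex 0 (by omega) L' hL' ?_)
    rw [h.t_zero]
    exact h.free_start L' hL'
  have hfinish : ∀ L' ∈ 𝓛, pos (S n) (τ (n + 1)) ∉ tube σ r L' := by
    refine fun L' hL' => hvertex n le_rfl L' hL' ?_
    rw [h.t_last]
    exact h.free_end L' hL'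
  have hstep : ∀ k < n + 1, IsStep 𝓛 σ r (S k) (τ k) (S (k + 1)) (τ (k + 1)) := by
    intro k hk
    have hkn : k ≤ n := by omega
    refine ⟨hτlt k hkn, hglue k hkn, fun u hu L' hL' => ?_, ?_, ?_⟩
    · by_cases haway : ∀ u ∈ Set.Icc (t k) (t (k + 1)), q u ∉ L'
      · obtain ⟨u', hu', -, hd⟩ := hclose k hkn u ⟨hu.1.le, hu.2.le⟩
        exact hout L' hL' _ _ hd (hcl.edge k hkn L' hL' haway u' hu')
      -- otherwise the edge starts or ends at a collision with `L'`, and convexity applies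
      push Not at haway
      obtain ⟨x, hx, hxL⟩ := haway
      have hxe : x = t k ∨ x = t (k + 1) := by
        by_contra! hne
        exact h.free k hkn x ⟨lt_of_le_of_ne hx.1 hne.1.symm, lt_of_le_of_ne hx.2 hne.2⟩ L' hL' hxL
      rw [mem_tube_iff, not_le]
      rcases hxe with rfl | rfl
      · rcases k with - | k
        · rw [h.t_zero] at hxL
          exact absurd hxL (h.free_start L' hL')
        · have hk' : k < n := by omega
          obtain rfl := h.eq_of_vertex_mem k hk' L' hL' hxL
          have hd := hsh.disc_pos k hk'
          have hc := hσ _ hL'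
          have h1 := inner_perp_reflectVel hc hd
          have h2 := (entry_spec hc hd).1
          have hp := pos_reflectLine (L (k + 1)) (σ (L (k + 1)) * r) (R k)
          rw [← hτsucc k hk', ← hSsucc k hk'] at hp
          rw [← hτsucc k hk', ← hp] at h1 h2
          rw [← h2]
          refine lt_norm_perp_of_exit hu.1 ?_
          rw [hSsucc k hk']
          rw [hSsucc k hk'] at h1
          exact (Real.sqrt_pos.2 hd).trans_eq h1.symm
      · rcases hkn.lt_or_eq with hk' | rfl
        · obtain rfl := h.eq_of_vertex_mem k hk' L' hL' hxL
          have hd := hsh.disc_pos k hk'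
          have hc := hσ _ hL'
          have h1 := entry_inner_neg hc hd
          have h2 := (entry_spec hc hd).1
          rw [← hτsucc k hk'] at h1 h2
          rw [hS k hkn, ← h2]
          exact lt_norm_perp_of_entry hu.2 h1
        · rw [h.t_last] at hxL
          exact absurd hxL (h.free_end L' hL')
    · rcases hkn.lt_or_eq with hk' | rfl
      · have := collisionLaw_reflectVel (hσ _ (h.mem k hk')) (hsh.disc_pos k hk')
          (fun L' hL' hne => by
            have := hvertex k hkn L' hL' fun hm => hne (h.eq_of_vertex_mem k hk' L' hL' hm)
            rwa [hS k hkn, hτsucc k hk'] at this) (h.mem k hk')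
        rw [hS k hkn, hτsucc k hk', hSsucc k hk']
        exact this
      · rw [hSlast, ← hS k le_rfl]
        exact collisionLaw_self hfinish _
    · rcases hkn.lt_or_eq with hk' | rfl
      · rw [hSsucc k hk', hS k hkn]
        exact norm_reflectVel (hσ _ (h.mem k hk')) (hsh.disc_pos k hk')
      · rw [hSlast, ← hS k le_rfl]
  have hgen : ∀ k ≤ n, IsGeneric 𝓛 σ r (R k) := by
    intro k hk
    induction k with
    | zero => exact hg
    | succ k ih => exact (ih (by omega)).reflectLine (h.mem k hk) (hsh.disc_pos k hk)
  obtain ⟨Q, hQ, hQS⟩ := PointBilliards.exists_isThickenedTrajectory hσ (m := n + 1) (s := S)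
    (τ := τ) (by rw [hS 0 n.zero_le]; exact hs) hstep (by rw [hSlast]; exact hgen n le_rfl)
    (fun L' hL' => Or.inl (by
      have := hfinish L' hL'
      rwa [mem_tube_iff, not_le, hglue n le_rfl] at this))
    (by rw [hS 0 n.zero_le]; exact hg') hstart
  have htmono : ∀ k ≤ n + 1, a ≤ t k ∧ t k ≤ b := by
    have h1 : ∀ k ≤ n + 1, a ≤ t k := by
      intro k hk
      induction k with
      | zero => exact h.t_zero.ge
      | succ k ih => exact (ih (by omega)).trans (h.lt_succ k (by omega)).le
    intro k hk
    refine ⟨h1 k hk, ?_⟩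
    induction hk using Nat.decreasingInduction with
    | self => exact h.t_last.le
    | of_succ k hk ih => exact (h.lt_succ k (by omega)).le.trans ih
  refine ⟨Q, hQ, fun u hu => ?_⟩
  obtain ⟨k, hk, hku⟩ := exists_mem_Icc_succ (τ := τ) (m := n + 1) (by omega) (u := u) (by
    rw [hτlast, h.t_last]
    exact ⟨h.t_zero.le.trans hu.1, hu.2⟩)
  obtain ⟨u', hu', h1, h2⟩ := hclose k (by omega) u hku
  have hu'ab : u' ∈ Set.Icc a b :=
    ⟨(htmono k (by omega)).1.trans hu'.1, hu'.2.trans (htmono (k + 1) (by omega)).2⟩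
  have h3 := hmod u hu u' hu'ab h1
  rw [hQS k hk u hku]
  calc ‖pos (S k) u - q u‖ = ‖(pos (S k) u - q u') - (q u - q u')‖ := by
        rw [sub_sub_sub_cancel_right]
    _ ≤ δ + ε := (norm_sub_le _ _).trans (add_le_add h2 h3)

lemma scale_rev (k : ℝ) (s : E × E) : rev (scale k s) = scale k (rev s) := by
  simp [rev, scale]

/-- On a bounded time interval, a transverse point billiard trajectory without multiple collisions
is a limit of thickened trajectories. -/
lemma IsItinerary.eventually_exists_isThickenedTrajectory (h : IsItinerary 𝓛 q a b n t v L)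
    (hq : Continuous q) (hσ : ∀ L ∈ 𝓛, 0 < σ L) {ε : ℝ} (hε : 0 < ε) :
    ∀ᶠ r in 𝓝[>] 0, ∃ Q : C(ℝ, E), IsThickenedTrajectory 𝓛 σ r Q ∧
      ∀ u ∈ Set.Icc a b, ‖Q u - q u‖ < ε := by
  have huc := isCompact_Icc.uniformContinuousOn_of_continuous (hq.continuousOn (s := Set.Icc a b))
  obtain ⟨η, hη, hηq⟩ := Metric.uniformContinuousOn_iff.1 huc (ε / 2) (half_pos hε)
  obtain ⟨δ, ⟨hcl, hδη, hδε⟩, hδ⟩ := (((h.eventually_isClearance hq).and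
    ((eventually_two_mul_lt hη).and (eventually_two_mul_lt hε))).and
      (eventually_mem_nhdsWithin (s := Set.Ioi (0 : ℝ)))).exists
  have hδ' : 0 < δ := hδ
  have hmod : ∀ u ∈ Set.Icc a b, ∀ u' ∈ Set.Icc a b, |u - u'| ≤ δ → ‖q u - q u'‖ ≤ ε / 2 := by
    intro u hu u' hu' huu
    have := hηq u hu u' hu' (by rw [Real.dist_eq]; linarith)
    rw [dist_eq_norm] at this
    exact this.le
  have htop : ∀ L ∈ 𝓛, L ≠ ⊤ := by
    rintro L' hL' rfl
    exact h.free_start _ hL' Submodule.mem_top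
  have hsmall : ∀ᶠ r in 𝓝[>] 0, ∀ L ∈ 𝓛, σ L * r < δ := by
    rw [eventually_all_finset]
    intro L' _
    have : Tendsto (fun r : ℝ => σ L' * r) (𝓝[>] 0) (𝓝 0) :=
      ((continuous_const.mul continuous_id).tendsto' 0 0 (by simp)).mono_left nhdsWithin_le_nhds
    exact this.eventually_lt_const hδ'
  filter_upwards [h.eventually_exists_isShadow hσ hδ', hsmall, eventually_mem_nhdsWithin]
    with r hr hrδ hr0
  obtain ⟨s, hs, hsh⟩ := hr
  have hσr : ∀ L ∈ 𝓛, 0 < σ L * r := fun L' hL' => mul_pos (hσ L' hL') hr0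
  -- perturb the shadowing motion to a generic one, and normalize its velocity
  have hnz : s.2 ≠ 0 := norm_ne_zero_iff.1 (by rw [hs]; exact one_ne_zero)
  have hN : ContinuousAt (fun s' : E × E => scale ‖s'.2‖⁻¹ s') s := by
    have : ContinuousAt (fun s' : E × E => ‖s'.2‖⁻¹) s :=
      ContinuousAt.inv₀ (by fun_prop) (norm_ne_zero_iff.2 hnz)
    unfold scale
    fun_prop
  have hNs : scale ‖s.2‖⁻¹ s = s := by simp [scale, hs]
  have hev : ∀ᶠ s' in 𝓝 s, s'.2 ≠ 0 ∧
      IsShadow n t (fun i => q (t i)) L (fun i => σ (L i) * r) δ (scale ‖s'.2‖⁻¹ s') := by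
    refine (continuousAt_snd.eventually_ne hnz).and (hN.tendsto.eventually ?_)
    rw [hNs]
    exact hsh.eventually
  obtain ⟨s', ⟨hs'3, hs'4⟩, hs'1, hs'2⟩ :=
    ((dense_isGeneric hσr htop).inter_nhds_nonempty hev)
  have hk : 0 < ‖s'.2‖⁻¹ := inv_pos.2 (norm_pos_iff.2 hs'1)
  obtain ⟨Q, hQ1, hQ2⟩ := h.exists_isThickenedTrajectory hδ' hcl hσr hrδ
    (s := scale ‖s'.2‖⁻¹ s') (by
      rw [scale, norm_smul, norm_inv, norm_norm, inv_mul_cancel₀ (norm_ne_zero_iff.2 hs'1)])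
    (hs'3.scale hσr hk) (by rw [scale_rev]; exact hs'4.scale hσr hk) hs'2 hmod
  exact ⟨Q, hQ1, fun u hu => (hQ2 u hu).trans_lt (by linarith)⟩

/-! ### Convergence in the compact-open topology -/

/-- A diagonal argument: approximations on each bounded time interval for all small values of the
parameter combine to a family converging uniformly on compact sets. -/
lemma exists_family_tendsto {P : ℝ → C(ℝ, E) → Prop} {q : C(ℝ, E)}
    (h : ∀ N : ℕ, ∀ᶠ r in 𝓝[>] (0 : ℝ), ∃ Q, P r Q ∧
      ∀ u ∈ Set.Icc (-(N : ℝ)) N, ‖Q u - q u‖ < 1 / (N + 1)) :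
    ∃ r₀ : ℝ, 0 < r₀ ∧ ∃ Q : ℝ → C(ℝ, E), (∀ r, 0 < r → r ≤ r₀ → P r (Q r)) ∧
      Tendsto Q (𝓝[>] 0) (𝓝 q) := by
  classical
  let G : ℝ → ℕ → Prop := fun r N => ∃ Q, P r Q ∧
    ∀ u ∈ Set.Icc (-(N : ℝ)) N, ‖Q u - q u‖ < 1 / (N + 1)
  obtain ⟨r₀, hr₀, hG0⟩ := mem_nhdsGT_iff_exists_Ioc_subset.1 (h 0)
  let M : ℝ → ℕ := fun r => Nat.findGreatest (G r) ⌊r⁻¹⌋₊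
  have hM : ∀ r, 0 < r → r ≤ r₀ → G r (M r) := fun r h1 h2 =>
    Nat.findGreatest_spec (P := G r) (Nat.zero_le _) (hG0 ⟨h1, h2⟩)
  let Q : ℝ → C(ℝ, E) := fun r => if hr : G r (M r) then hr.choose else 0
  have hQ : ∀ r, 0 < r → r ≤ r₀ → P r (Q r) ∧
      ∀ u ∈ Set.Icc (-(M r : ℝ)) (M r), ‖Q r u - q u‖ < 1 / (M r + 1) := by
    intro r h1 h2
    have hr := hM r h1 h2
    simp only [Q, dif_pos hr]
    exact hr.choose_spec
  refine ⟨r₀, hr₀, Q, fun r h1 h2 => (hQ r h1 h2).1, ?_⟩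
  rw [ContinuousMap.tendsto_iff_forall_isCompact_tendstoUniformlyOn]
  intro K hK
  rw [Metric.tendstoUniformlyOn_iff]
  intro ε hε
  obtain ⟨B, hB⟩ := hK.isBounded.exists_norm_le
  obtain ⟨N₁, hN₁⟩ := exists_nat_ge B
  obtain ⟨N₂, hN₂⟩ := exists_nat_one_div_lt hε
  set N := max N₁ N₂ with hN
  have hinv : ∀ᶠ r : ℝ in 𝓝[>] 0, (N : ℝ) ≤ r⁻¹ :=
    tendsto_inv_nhdsGT_zero.eventually_ge_atTop _
  filter_upwards [h N, hinv, Ioc_mem_nhdsGT hr₀] with r h1 h2 h3 u hu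
  have hNM : N ≤ M r := Nat.le_findGreatest (Nat.le_floor h2) h1
  have hu' : |u| ≤ M r := by
    have h4 := hB u hu
    rw [Real.norm_eq_abs] at h4
    have h5 : (N₁ : ℝ) ≤ M r := by exact_mod_cast (le_max_left N₁ N₂).trans hNM
    linarith
  have h6 := (hQ r h3.1 h3.2).2 u (abs_le.1 hu')
  have h7 : (N₂ : ℝ) ≤ M r := by exact_mod_cast (le_max_right N₁ N₂).trans hNM
  rw [dist_comm, dist_eq_norm]
  refine h6.trans (lt_of_le_of_lt ?_ hN₂)
  gcongr

lemma exists_collisionFree_mem_Ioo {q : C(ℝ, E)} (hq : IsPointBilliardTrajectory 𝓛 q) {c d : ℝ}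
    (hcd : c < d) : ∃ u ∈ Set.Ioo c d, q u ∉ collisionLocus 𝓛 := by
  have h1 : ∀ᶠ u in 𝓝[>] c, q u ∉ collisionLocus 𝓛 :=
    (hq.discrete_collisions c).filter_mono (nhdsWithin_mono _ fun x hx => ne_of_gt hx)
  obtain ⟨u, hu1, hu2⟩ := (h1.and (Ioo_mem_nhdsGT hcd)).exists
  exact ⟨u, hu2, hu1⟩

lemma eventually_exists_isThickenedTrajectory_near {q : C(ℝ, E)}
    (hσ : ∀ L ∈ 𝓛, 0 < σ L) (hq : IsPointBilliardTrajectory 𝓛 q)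
    (hmult : HasNoMultipleCollisions 𝓛 q) (htrans : IsTransverse 𝓛 q) {T ε : ℝ} (hT : 0 ≤ T)
    (hε : 0 < ε) :
    ∀ᶠ r in 𝓝[>] 0, ∃ Q : C(ℝ, E), IsThickenedTrajectory 𝓛 σ r Q ∧
      ∀ u ∈ Set.Icc (-T) T, ‖Q u - q u‖ < ε := by
  obtain ⟨a, ha, haC⟩ := exists_collisionFree_mem_Ioo hq (show -T - 1 < -T by linarith)
  obtain ⟨b, hb, hbC⟩ := exists_collisionFree_mem_Ioo hq (show T < T + 1 by linarith)
  obtain ⟨n, t, v, L, hI⟩ := exists_isItinerary hq hmult htrans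
    (show a < b by linarith [ha.2, hb.1]) haC hbC
  filter_upwards [hI.eventually_exists_isThickenedTrajectory q.continuous hσ hε] with r hr
  obtain ⟨Q, hQ, hQq⟩ := hr
  exact ⟨Q, hQ, fun u hu => hQq u ⟨ha.2.le.trans hu.1, hu.2.trans hb.1.le⟩⟩

end PointBilliards

theorem mainTheorem6 {E : Type*} [NormedAddCommGroup E] [InnerProductSpace ℝ E]
    [FiniteDimensional ℝ E] (𝓛 : Finset (Submodule ℝ E))
    (σ : Submodule ℝ E → ℝ) (hσ : ∀ L ∈ 𝓛, 0 < σ L)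
    (q : C(ℝ, E)) (hq : PointBilliards.IsPointBilliardTrajectory 𝓛 q)
    (hmult : PointBilliards.HasNoMultipleCollisions 𝓛 q)
    (htrans : PointBilliards.IsTransverse 𝓛 q) :
    ∃ r₀ : ℝ, 0 < r₀ ∧ ∃ Q : ℝ → C(ℝ, E), PointBilliards.IsRFamily 𝓛 σ q r₀ Q :=
  PointBilliards.exists_family_tendsto fun N =>
    PointBilliards.eventually_exists_isThickenedTrajectory_near hσ hq hmult htrans N.cast_nonneg
      Nat.one_div_pos_of_nat
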